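/- Let $F_2$ be the free group on $a,b$. A word is a finite sequence of letters from $\{a,a^{-1},b,b^{-1}\}$; it is cyclically reduced if it is reduced and its first and last letters are not inverse to each other (the empty word counts as cyclically reduced). An element of $F_2$ is positive if it is a product of the generators $a,b$ without inverses (the empty product is allowed), and potentially positive if some automorphism of $F_2$ maps it to a positive element. Let $\mathrm{PP}_2$ be the set of cyclically reduced words that represent potentially positive elements of $F_2$. Let $M$ be the directed graph with nodes $s_1,\dots,s_5$, labeled $a,\,b^{-1},\,a,\,b,\,a^{-1}$ respectively, and with the edges $$s_1\to s_1,\ s_1\to s_2,\ s_1\to s_4,\quad s_2\to s_3,\quad s_3\to s_3,\ s_3\to s_4,\quad s_4\to s_4,\ s_4\to s_1,\ s_4\to s_5,\quad s_5\to s_5,\ s_5\to s_4 .$$ Let $R^\infty$ be the set of words read along the closed paths of $M$, that is, the label sequences of all finite sequences of nodes (including the empty one) in which there is an edge from each node to the next one and an edge from the last node to the first. For a set $S$ of words let $\mathfrak g_n(S)$ be the number of words of length $n$ in $S$. A subset $B\subseteq A$ is called negligible in $A$ if $\displaystyle\lim_{n\to\infty}\frac{\mathfrak g_n(B)+1}{\mathfrak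 g_n(A)+1}=0$. **Lemma.** $R^\infty\subseteq \mathrm{PP}_2$, and $R^\infty$ is not negligible in $\mathrm{PP}_2$; that is, $\dfrac{\mathfrak g_n(R^\infty)+1}{\mathfrak g_n(\mathrm{PP}_2)+1}$ does not tend to $0$ as $n\to\infty$. -/

import Mathlib

open Filter Topology

namespace PotPos

/-! ### Growth and density of sets of words -/

/-- The growth function: the number of words of length `n` in `S`. (Over a finite alphabet, the
only case of interest, the counted set is finite.) -/
noncomputable def growth {A : Type*} (S : Set (List A)) (n : ℕ) : ℕ :=
  {w : List A | w ∈ S ∧ w.length = n}.ncard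

/-- The density function of `B` in `A`. -/
noncomputable def density {L : Type*} (B A : Set (List L)) (n : ℕ) : ℝ :=
  ((growth B n : ℝ) + 1) / ((growth A n : ℝ) + 1)

/-- `B` (a subset of `A`) is negligible in `A`: the density tends to `0`. -/
def Negligible {L : Type*} (B A : Set (List L)) : Prop :=
  Tendsto (density B A) atTop (𝓝 0)

/-! ### Potentially positive words

Words in the generators of the free group of rank `r` and their inverses are lists over
`Fin r × Bool`, where `(i, true)` is the `i`-th generator and `(i, false)` its inverse. -/

/-- An element of a free group is positive if it is a product of generators, without inverses. -/
def Positive {X : Type*} (g : FreeGroup X) : Prop :=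
  g ∈ Submonoid.closure (Set.range (FreeGroup.of : X → FreeGroup X))

/-- An element is potentially positive if some automorphism maps it to a positive element. -/
def PotentiallyPositive {X : Type*} (g : FreeGroup X) : Prop :=
  ∃ φ : FreeGroup X ≃* FreeGroup X, Positive (φ g)

/-- `PP r`: the cyclically reduced potentially positive words in the free group of rank `r`. -/
def PP (r : ℕ) : Set (List (Fin r × Bool)) :=
  {w | FreeGroup.IsCyclicallyReduced w ∧ PotentiallyPositive (FreeGroup.mk w)}

/-! ### Automata generating words by closed paths -/

/-- An automaton: a directed graph on the set `V` of nodes, whose nodes are labeled by letters. -/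
structure Automaton (V A : Type*) where
  graph : Digraph V
  label : V → A

/-- A finite path is a sequence of nodes with an edge from each node to the next one; it is closed
if there is an edge from its last node to its first node. The empty path is closed. -/
def IsClosedPath {V : Type*} (G : Digraph V) (p : List V) : Prop :=
  p.IsChain G.Adj ∧ ∀ x ∈ p.head?, ∀ y ∈ p.getLast?, G.Adj y x

/-- The set of words generated by an automaton: the label sequences of its closed paths. -/
def Automaton.language {V A : Type*} (M : Automaton V A) : Set (List A) :=
  {w | ∃ p : List V, IsClosedPath M.graph p ∧ p.map M.label = w}

/-- The lower-bound automaton of rank two. With `a = (0, true)`, `b = (1, true)` and inverses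
`a⁻¹ = (0, false)`, `b⁻¹ = (1, false)`, its nodes `0, 1, 2, 3, 4` are labeled
`a, b⁻¹, a, b, a⁻¹`. -/
def lowerBoundAutomaton : Automaton (Fin 5) (Fin 2 × Bool) where
  graph := { Adj := fun i j => (i, j) ∈
    ([(0, 0), (0, 1), (0, 3),
      (1, 2),
      (2, 2), (2, 3),
      (3, 3), (3, 0), (3, 4),
      (4, 4), (4, 3)] : List (Fin 5 × Fin 5)) }
  label := ![(0, true), (1, false), (0, true), (1, true), (0, false)]

/-- `R^∞`: the set of words generated by the lower-bound automaton. -/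
def Rinf : Set (List (Fin 2 × Bool)) :=
  lowerBoundAutomaton.language

end PotPos

namespace PotPos

/-! ### Reduced words -/

section Words

variable {α : Type*}

/-! Inclusion. The automorphism `autPos N` sends `a ↦ ab`, `b ↦ b(ab)^N`. Along a path that starts
at the node labeled `b`, the image, multiplied on the left by `(ab)^N`, keeps the form `P(ab)^j`
with `P` positive: each `b` leaves a stock of `N` factors `ab`, each `a⁻¹` uses up one, and `b⁻¹`,
which is only reached with stock `N + 1`, uses up the stock and leaves a positive element. A closed
path through that node therefore has an image conjugate to a positive element (`PathInv.step`,
`rinf_subset_PP`).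

Structure of `PP 2`. By Nielsen's theorem (`nielsen_eq_top`) and the relations of `GL₂(ℤ) =
Out(F₂)`, every automorphism is, up to inner ones, a signed permutation applied after a product of
`autU`, `autL` or a product of their inverses (`exists_conj_normalForm`). The first kind of product
preserves positivity. For the second kind, cyclic words are cut into runs `b^ε a^k`, and
`MixedClass` is a class of conjugacy classes stable under the inverses. It follows that, up to a
permutation of the letters, a word of `PP 2` lies in `Rinf` or contains cyclically some `b⁻¹a^K b⁻¹`
with `K ≥ 1` minimal, the other exponents being constrained by `RunRel K` (`exists_perm_of_mem_PP`).

Counting. If `x` is the root near 0.4 of `x⁴ - x³ - x² + 3x - 1`, an eigenvector argument gives at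
least a constant times `x⁻ⁿ` words of length `n` in `Rinf` (`le_growth_rinf`). The exceptional words
with parameter `K` have a growth rate smaller by a factor of at least `1 + x^K/200`
(`perturbed_inequalities`). Summed over `K` and over the `n` rotations they still number only
`O(x⁻ⁿ)` for even `n` (`sum_div_sq_le`). Hence `growth (PP 2)` is at most a constant times `growth
Rinf` at even lengths, and the density cannot tend to 0. -/

theorem exists_cancellation [DecidableEq α] {A B : List (α × Bool)} (hA : FreeGroup.IsReduced A)
    (hB : FreeGroup.IsReduced B) :
    ∃ u c v, A = u ++ FreeGroup.invRev c ∧ B = c ++ v ∧ FreeGroup.IsReduced (u ++ v) := by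
  induction A using List.reverseRecOn generalizing B with
  | nil => exact ⟨[], [], B, by simp, by simp, by simpa using hB⟩
  | append_singleton A z ih =>
    have hA' : FreeGroup.IsReduced A := hA.infix ⟨[], [z], by simp⟩
    rcases B with _ | ⟨y, B⟩
    · exact ⟨A ++ [z], [], [], by simp, by simp, by simpa using hA⟩
    · by_cases h : y = (z.1, !z.2)
      · have hB' : FreeGroup.IsReduced B := hB.infix ⟨[y], [], by simp⟩
        obtain ⟨u, c, v, h1, h2, h3⟩ := ih hA' hB'
        refine ⟨u, y :: c, v, ?_, by simp [h2], h3⟩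
        simp [h1, h, FreeGroup.invRev]
      · refine ⟨A ++ [z], [], y :: B, by simp, by simp, ?_⟩
        refine List.IsChain.append hA hB ?_
        intro a ha b hb
        simp only [List.getLast?_append_of_ne_nil, List.getLast?_singleton, ne_eq,
          List.cons_ne_self, not_false_eq_true, Option.mem_def, Option.some.injEq,
          List.head?_cons] at ha hb
        subst ha hb
        intro h1
        by_contra h2
        apply h
        rcases z with ⟨z1, z2⟩
        rcases y with ⟨y1, y2⟩
        simp only at h1 h2
        cases z2 <;> cases y2 <;> simp_all

theorem norm_eq_of_isReduced [DecidableEq α] {L : List (α × Bool)} (h : FreeGroup.IsReduced L) :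
    (FreeGroup.mk L).norm = L.length := by
  rw [FreeGroup.norm, FreeGroup.toWord_mk, h.reduce_eq]

theorem exists_cancellation_mul [DecidableEq α] (p q : FreeGroup α) :
    ∃ u c v, p.toWord = u ++ FreeGroup.invRev c ∧ q.toWord = c ++ v ∧
      (p * q).toWord = u ++ v := by
  obtain ⟨u, c, v, h1, h2, h3⟩ := exists_cancellation (FreeGroup.isReduced_toWord (x := p))
    (FreeGroup.isReduced_toWord (x := q))
  refine ⟨u, c, v, h1, h2, ?_⟩
  have : p * q = FreeGroup.mk (u ++ v) := by
    rw [← FreeGroup.mk_toWord (x := p), ← FreeGroup.mk_toWord (x := q), h1, h2,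
      ← FreeGroup.mul_mk, ← FreeGroup.mul_mk, ← FreeGroup.mul_mk, ← FreeGroup.inv_mk]
    group
  rw [this, FreeGroup.toWord_mk, h3.reduce_eq]

/-- The hypothesis says that the parts of `q` cancelled by `p` and by `r` do not exhaust `q`. A
nonempty middle part `m` survives and separates the two cancellations. -/
theorem norm_mul_mul [DecidableEq α] (p q r : FreeGroup α)
    (h : p.norm + r.norm < (p * q).norm + (q * r).norm) :
    (p * q * r).norm + q.norm = (p * q).norm + (q * r).norm := by
  obtain ⟨u, c, v, hp, hq, hpq⟩ := exists_cancellation_mul p q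
  obtain ⟨v', d, w, hq', hr, hqr⟩ := exists_cancellation_mul q r
  have e1 : p.norm = u.length + c.length := by simp [FreeGroup.norm, hp]
  have e2 : q.norm = c.length + v.length := by simp [FreeGroup.norm, hq]
  have e2' : q.norm = v'.length + d.length := by simp [FreeGroup.norm, hq']
  have e3 : r.norm = d.length + w.length := by simp [FreeGroup.norm, hr]
  have e4 : (p * q).norm = u.length + v.length := by simp [FreeGroup.norm, hpq]
  have e5 : (q * r).norm = v'.length + w.length := by simp [FreeGroup.norm, hqr]
  have hlt : c.length < v'.length := by omega
  obtain ⟨m, hm⟩ : ∃ m, v' = c ++ m := by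
    have : c <+: v' := by
      refine List.prefix_of_prefix_length_le (l₃ := q.toWord) ⟨v, hq.symm⟩ ⟨_, hq'.symm⟩ hlt.le
    obtain ⟨m, hm⟩ := this
    exact ⟨m, hm.symm⟩
  have hm0 : m ≠ [] := by
    rintro rfl
    simp [hm] at hlt
  have hv : v = m ++ FreeGroup.invRev d := by
    have := hq.symm.trans hq'
    rw [hm, List.append_assoc] at this
    exact List.append_cancel_left this
  have hr1 : FreeGroup.IsReduced (u ++ m) := by
    have := FreeGroup.isReduced_toWord (x := p * q)
    rw [hpq, hv] at this
    exact this.infix ⟨[], FreeGroup.invRev d, by simp⟩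
  have hr2 : FreeGroup.IsReduced (m ++ w) := by
    have := FreeGroup.isReduced_toWord (x := q * r)
    rw [hqr, hm] at this
    exact this.infix ⟨c, [], by simp⟩
  have hr3 : FreeGroup.IsReduced (u ++ m ++ w) := FreeGroup.IsReduced.append_overlap hr1 hr2 hm0
  have : p * q * r = FreeGroup.mk (u ++ m ++ w) := by
    rw [← FreeGroup.mk_toWord (x := p * q), ← FreeGroup.mk_toWord (x := r), hpq, hr, hv]
    simp only [← FreeGroup.mul_mk, ← FreeGroup.inv_mk]
    group
  rw [this, norm_eq_of_isReduced hr3]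
  have : v.length = m.length + d.length := by simp [hv]
  have : v'.length = c.length + m.length := by simp [hm]
  simp only [List.length_append]
  omega

/-! ### Cyclic reduction and conjugacy. -/

/-- Two letters that may follow each other in a reduced word. -/
def NotCancel (p q : α × Bool) : Prop := p.1 = q.1 → p.2 = q.2

theorem isCyclicallyReduced_iff_chain {w : List (α × Bool)} :
    FreeGroup.IsCyclicallyReduced w ↔ Cycle.Chain NotCancel (w : Cycle (α × Bool)) := by
  rcases w with _ | ⟨x, w⟩
  · simp
  · rw [Cycle.chain_coe_cons, ← List.cons_append, List.isChain_append,
      FreeGroup.isCyclicallyReduced_iff]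
    simp only [List.IsChain.singleton, true_and, List.head?_cons, Option.mem_some_iff]
    rfl

theorem _root_.List.IsRotated.isCyclicallyReduced {w w' : List (α × Bool)} (h : w ~r w')
    (hw : FreeGroup.IsCyclicallyReduced w) : FreeGroup.IsCyclicallyReduced w' := by
  rw [isCyclicallyReduced_iff_chain] at hw ⊢
  rwa [← Cycle.coe_eq_coe.2 h]

/-- The last letter of the conjugator either cancels against an end of `w`, which amounts to a
rotation of `w`, or nothing cancels at all. In the latter case `w'` is literally `c w c⁻¹`, whose
first and last letters are inverse. -/
theorem isRotated_of_conj [DecidableEq α] (c : List (α × Bool)) : ∀ {w w' : List (α × Bool)},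
    FreeGroup.IsReduced c →
    FreeGroup.IsCyclicallyReduced w → FreeGroup.IsCyclicallyReduced w' →
    FreeGroup.mk c * FreeGroup.mk w * (FreeGroup.mk c)⁻¹ = FreeGroup.mk w' → w ~r w' := by
  have key : ∀ {A B : List (α × Bool)}, FreeGroup.IsReduced A → FreeGroup.IsReduced B →
      FreeGroup.mk A = FreeGroup.mk B → A = B := by
    intro A B hA hB h
    have := FreeGroup.reduce.sound h
    rwa [hA.reduce_eq, hB.reduce_eq] at this
  induction c using List.reverseRecOn with
  | nil =>
    intro w w' _ hw hw' h
    simp only [← FreeGroup.one_eq_mk, one_mul, inv_one, mul_one] at h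
    rw [key hw.1 hw'.1 h]
  | append_singleton c x ih =>
    intro w w' hc hw hw' h
    have hc' : FreeGroup.IsReduced c := hc.infix ⟨[], [x], by simp⟩
    rcases List.eq_nil_or_concat' w with rfl | ⟨w1, z, rfl⟩
    · simp only [← FreeGroup.one_eq_mk, mul_one, mul_inv_cancel] at h
      rw [FreeGroup.one_eq_mk] at h
      rw [key (by simp) hw'.1 h]
    by_cases hz : z = x
    · subst hz
      have hrot : (w1 ++ [z]) ~r (z :: w1) := by
        simpa using (List.isRotated_append (l := w1) (l' := [z]))
      refine hrot.trans (ih hc' (hrot.isCyclicallyReduced hw) hw' ?_)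
      rw [← h, ← List.singleton_append, ← FreeGroup.mul_mk, ← FreeGroup.mul_mk, ← FreeGroup.mul_mk]
      group
    · rcases hw1 : w1 ++ [z] with _ | ⟨y, w2⟩
      · simp at hw1
      rw [hw1] at hw h
      by_cases hy : y = (x.1, !x.2)
      · have hrot : (y :: w2) ~r (w2 ++ [y]) := by
          simpa using (List.isRotated_append (l := [y]) (l' := w2))
        refine hrot.trans (ih hc' (hrot.isCyclicallyReduced hw) hw' ?_)
        have hx : FreeGroup.mk [y] = (FreeGroup.mk [x])⁻¹ := by
          rw [hy]; simp [FreeGroup.inv_mk, FreeGroup.invRev]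
        rw [← h, ← List.singleton_append (l := w2)]
        simp only [← FreeGroup.mul_mk, hx]
        group
      · exfalso
        have hcw : FreeGroup.IsReduced (c ++ [x] ++ (y :: w2)) := by
          refine List.IsChain.append hc hw.1 ?_
          intro a ha b hb
          simp at ha hb
          subst ha hb
          intro h1
          by_contra h2
          apply hy
          rcases x with ⟨x1, x2⟩
          rcases y with ⟨y1, y2⟩
          simp only at h1 h2
          cases x2 <;> cases y2 <;> simp_all
        have hinv : FreeGroup.IsReduced (FreeGroup.invRev (c ++ [x])) := by
          rw [FreeGroup.isReduced_iff_reduce_eq, FreeGroup.reduce_invRev, hc.reduce_eq]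
        have hcwc : FreeGroup.IsReduced (c ++ [x] ++ (y :: w2) ++ FreeGroup.invRev (c ++ [x])) := by
          refine List.IsChain.append hcw hinv ?_
          intro a ha b hb
          rw [← hw1, ← List.append_assoc, List.getLast?_concat] at ha
          simp only [Option.mem_def, Option.some.injEq] at ha
          simp [FreeGroup.invRev] at hb
          subst ha
          subst hb
          intro h1
          by_contra h2
          apply hz
          rcases x with ⟨x1, x2⟩
          rcases z with ⟨y1, y2⟩
          simp only at h1 h2
          cases x2 <;> cases y2 <;> simp_all
        have := key hcwc hw'.1 (by
          rw [← h, ← FreeGroup.mul_mk, ← FreeGroup.mul_mk (L₁ := c ++ [x]) , ← FreeGroup.inv_mk])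
        subst this
        have h3 := hw'.2
        have key2 : ∀ (y : α × Bool) (l : List (α × Bool)),
            ¬ (∀ a ∈ (y :: l ++ [(y.1, !y.2)]).getLast?, ∀ b ∈ (y :: l ++ [(y.1, !y.2)]).head?,
              a.1 = b.1 → a.2 = b.2) := by
          intro y l h
          rw [List.getLast?_concat] at h
          simp at h
        rcases c with _ | ⟨c0, c⟩
        · refine key2 x (y :: w2) ?_
          simpa [FreeGroup.invRev] using h3
        · refine key2 c0 (c ++ [x] ++ y :: w2 ++ FreeGroup.invRev (c ++ [x])) ?_
          simpa [FreeGroup.invRev] using h3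

theorem isRotated_of_isConj {w w' : List (α × Bool)} (hw : FreeGroup.IsCyclicallyReduced w)
    (hw' : FreeGroup.IsCyclicallyReduced w') (h : IsConj (FreeGroup.mk w) (FreeGroup.mk w')) :
    w ~r w' := by
  classical
  obtain ⟨c, hc⟩ := isConj_iff.1 h
  exact isRotated_of_conj c.toWord FreeGroup.isReduced_toWord hw hw' (by
    rw [FreeGroup.mk_toWord]; exact hc)

theorem isConj_of_isRotated {w w' : List (α × Bool)} (h : w ~r w') :
    IsConj (FreeGroup.mk w) (FreeGroup.mk w') := by
  obtain ⟨n, rfl⟩ := h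
  induction n generalizing w with
  | zero => rw [List.rotate_zero]
  | succ n ih =>
    rcases w with _ | ⟨x, w⟩
    · rw [List.rotate_nil]
    · rw [List.rotate_cons_succ]
      refine IsConj.trans ?_ ih
      rw [isConj_iff]
      refine ⟨(FreeGroup.mk [x])⁻¹, ?_⟩
      rw [← List.singleton_append (l := w)]
      simp only [← FreeGroup.mul_mk]
      group

end Words

/-! ### Generators of the automorphism group of the free group of rank two -/

section Nielsen

theorem even_norm_mul {α : Type*} [DecidableEq α] (p q : FreeGroup α) :
    ∃ k, p.norm + q.norm = (p * q).norm + 2 * k := by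
  obtain ⟨u, c, v, hp, hq, hpq⟩ := exists_cancellation_mul p q
  refine ⟨c.length, ?_⟩
  simp [FreeGroup.norm, hp, hq, hpq]
  ring

/-- If at least half of `g` cancelled in `g * g`, comparing the two factorizations of `g` would give
`g = u d u⁻¹` with `d` equal to its formal inverse. Then `d² = 1`, and `d = 1` because free groups
have unique roots. -/
theorem norm_lt_norm_mul_self {α : Type*} [DecidableEq α] {g : FreeGroup α} (hg : g ≠ 1) :
    g.norm < (g * g).norm := by
  by_contra hlt
  push Not at hlt
  obtain ⟨u, c, v, h1, h2, h3⟩ := exists_cancellation_mul g g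
  have e1 : g.norm = u.length + c.length := by simp [FreeGroup.norm, h1]
  have e2 : g.norm = c.length + v.length := by simp [FreeGroup.norm, h2]
  have e3 : (g * g).norm = u.length + v.length := by simp [FreeGroup.norm, h3]
  obtain ⟨d, rfl⟩ : ∃ d, c = u ++ d := by
    have : u <+: c := List.prefix_of_prefix_length_le (l₃ := g.toWord) ⟨_, h1.symm⟩ ⟨v, h2.symm⟩
      (by omega)
    obtain ⟨d, hd⟩ := this
    exact ⟨d, hd.symm⟩
  have h4 : d ++ v = FreeGroup.invRev d ++ FreeGroup.invRev u := by
    have := h2.symm.trans h1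
    rw [List.append_assoc, FreeGroup.invRev_append] at this
    exact List.append_cancel_left this
  obtain ⟨h5, h6⟩ := List.append_inj h4 (by simp)
  have h7 : FreeGroup.mk d = 1 := by
    have h8 : (FreeGroup.mk d) ^ 2 = 1 ^ 2 := by
      rw [pow_two]
      nth_rw 1 [h5]
      rw [← FreeGroup.inv_mk, inv_mul_cancel, one_pow]
    exact pow_left_injective two_ne_zero h8
  apply hg
  rw [← FreeGroup.mk_toWord (x := g), h2, h6, ← FreeGroup.mul_mk, ← FreeGroup.mul_mk, h7,
    ← FreeGroup.inv_mk]
  group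

/-- The free group of rank two. -/
abbrev F2 := FreeGroup (Fin 2)

/-- The automorphism exchanging the generators. -/
def autSwap : MulAut F2 :=
  MonoidHom.toMulEquiv (FreeGroup.lift ![FreeGroup.of 1, FreeGroup.of 0])
    (FreeGroup.lift ![FreeGroup.of 1, FreeGroup.of 0])
    (by ext i; fin_cases i <;> simp) (by ext i; fin_cases i <;> simp)

/-- The automorphism inverting the first generator. -/
def autInv : MulAut F2 :=
  MonoidHom.toMulEquiv (FreeGroup.lift ![(FreeGroup.of 0)⁻¹, FreeGroup.of 1])
    (FreeGroup.lift ![(FreeGroup.of 0)⁻¹, FreeGroup.of 1])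
    (by ext i; fin_cases i <;> simp) (by ext i; fin_cases i <;> simp)

/-- The automorphism `a ↦ ab`, `b ↦ b`. -/
def autU : MulAut F2 :=
  MonoidHom.toMulEquiv (FreeGroup.lift ![FreeGroup.of 0 * FreeGroup.of 1, FreeGroup.of 1])
    (FreeGroup.lift ![FreeGroup.of 0 * (FreeGroup.of 1)⁻¹, FreeGroup.of 1])
    (by ext i; fin_cases i <;> simp) (by ext i; fin_cases i <;> simp)

/-- The automorphism `a ↦ a`, `b ↦ ba`. -/
def autL : MulAut F2 :=
  MonoidHom.toMulEquiv (FreeGroup.lift ![FreeGroup.of 0, FreeGroup.of 1 * FreeGroup.of 0])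
    (FreeGroup.lift ![FreeGroup.of 0, FreeGroup.of 1 * (FreeGroup.of 0)⁻¹])
    (by ext i; fin_cases i <;> simp) (by ext i; fin_cases i <;> simp)

@[simp] theorem autSwap_zero : autSwap (FreeGroup.of 0) = FreeGroup.of 1 := by simp [autSwap]
@[simp] theorem autSwap_one : autSwap (FreeGroup.of 1) = FreeGroup.of 0 := by simp [autSwap]
@[simp] theorem autInv_zero : autInv (FreeGroup.of 0) = (FreeGroup.of 0)⁻¹ := by simp [autInv]
@[simp] theorem autInv_one : autInv (FreeGroup.of 1) = FreeGroup.of 1 := by simp [autInv]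
@[simp] theorem autU_zero : autU (FreeGroup.of 0) = FreeGroup.of 0 * FreeGroup.of 1 := by
  simp [autU]
@[simp] theorem autU_one : autU (FreeGroup.of 1) = FreeGroup.of 1 := by simp [autU]
@[simp] theorem autL_zero : autL (FreeGroup.of 0) = FreeGroup.of 0 := by simp [autL]
@[simp] theorem autL_one : autL (FreeGroup.of 1) = FreeGroup.of 1 * FreeGroup.of 0 := by
  simp [autL]
@[simp] theorem autU_symm_zero :
    MulEquiv.symm autU (FreeGroup.of 0) = FreeGroup.of 0 * (FreeGroup.of 1)⁻¹ := by
  rw [MulEquiv.symm_apply_eq]; simp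
@[simp] theorem autU_symm_one : MulEquiv.symm autU (FreeGroup.of 1) = FreeGroup.of 1 := by
  rw [MulEquiv.symm_apply_eq]; simp
@[simp] theorem autL_symm_zero : MulEquiv.symm autL (FreeGroup.of 0) = FreeGroup.of 0 := by
  rw [MulEquiv.symm_apply_eq]; simp
@[simp] theorem autL_symm_one :
    MulEquiv.symm autL (FreeGroup.of 1) = FreeGroup.of 1 * (FreeGroup.of 0)⁻¹ := by
  rw [MulEquiv.symm_apply_eq]; simp

theorem mulAut_ext {φ ψ : MulAut F2} (h0 : φ (FreeGroup.of 0) = ψ (FreeGroup.of 0))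
    (h1 : φ (FreeGroup.of 1) = ψ (FreeGroup.of 1)) : φ = ψ := by
  have : φ.toMonoidHom = ψ.toMonoidHom := by
    ext i
    fin_cases i
    · exact h0
    · exact h1
  ext x
  exact DFunLike.congr_fun this x

/-- The automorphisms permuting the letters. -/
def signedPerms : Subgroup (MulAut F2) := Subgroup.closure {autSwap, autInv}

theorem autSwap_mem : autSwap ∈ signedPerms := Subgroup.subset_closure (by simp)
theorem autInv_mem : autInv ∈ signedPerms := Subgroup.subset_closure (by simp)

theorem exists_signedPerm {p q : Fin 2 × Bool} (h : p.1 ≠ q.1) :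
    ∃ σ ∈ signedPerms, σ (FreeGroup.of 0) = FreeGroup.mk [p] ∧
      σ (FreeGroup.of 1) = FreeGroup.mk [q] := by
  have of_true : ∀ i : Fin 2, FreeGroup.mk [(i, true)] = FreeGroup.of i := fun _ => rfl
  have of_false : ∀ i : Fin 2, FreeGroup.mk [(i, false)] = (FreeGroup.of i)⁻¹ := fun _ => rfl
  have hS := autSwap_mem
  have hE := autInv_mem
  rcases p with ⟨i, s⟩
  rcases q with ⟨j, t⟩
  fin_cases i <;> fin_cases j <;> simp only [Fin.zero_eta, Fin.mk_one, ne_eq, not_true] at h ⊢ <;>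
    cases s <;> cases t <;> simp only [of_true, of_false]
  · exact ⟨autInv * (autSwap * autInv * autSwap),
      mul_mem hE (mul_mem (mul_mem hS hE) hS), by simp, by simp⟩
  · exact ⟨autInv, hE, by simp, by simp⟩
  · exact ⟨autSwap * autInv * autSwap, by simp only [mul_mem, hS, hE], by simp, by simp⟩
  · exact ⟨1, one_mem _, by simp, by simp⟩
  · exact ⟨autSwap * autInv * (autSwap * autInv * autSwap),
      mul_mem (mul_mem hS hE) (mul_mem (mul_mem hS hE) hS), by simp, by simp⟩
  · exact ⟨autSwap * autInv, by simp only [mul_mem, hS, hE], by simp, by simp⟩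
  · exact ⟨autInv * autSwap, by simp only [mul_mem, hS, hE], by simp, by simp⟩
  · exact ⟨autSwap, hS, by simp, by simp⟩

/-- The subgroup generated by the elementary Nielsen automorphisms and the inner automorphisms. -/
def nielsen : Subgroup (MulAut F2) :=
  Subgroup.closure ({autSwap, autInv, autU} ∪ Set.range (MulAut.conj : F2 →* MulAut F2))

theorem signedPerms_le_nielsen : signedPerms ≤ nielsen := by
  refine Subgroup.closure_mono ?_
  intro x hx
  simp only [Set.mem_insert_iff, Set.mem_singleton_iff] at hx
  rcases hx with rfl | rfl <;> simp

theorem autU_mem : autU ∈ nielsen := Subgroup.subset_closure (by simp)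

theorem conj_mem (g : F2) : MulAut.conj g ∈ nielsen := Subgroup.subset_closure (Or.inr ⟨g, rfl⟩)

/-- The total length of the images of the generators. -/
def autSize (φ : MulAut F2) : ℕ := (φ (FreeGroup.of 0)).norm + (φ (FreeGroup.of 1)).norm

theorem mk_inv_letter {α : Type*} (p : α × Bool) :
    FreeGroup.mk [(p.1, !p.2)] = (FreeGroup.mk [p])⁻¹ := rfl

theorem letter_ne_one {α : Type*} (p : α × Bool) : FreeGroup.mk [p] ≠ 1 := by
  classical
  intro h
  have h1 := norm_eq_of_isReduced (L := [p]) (by simp [FreeGroup.IsReduced])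
  rw [h] at h1
  simp at h1

/-! ### Lengths under Nielsen-minimal automorphisms. -/

section Minimal

/-- The images of the generators are as short as possible, up to Nielsen automorphisms. -/
def NielsenMinimal (ψ : MulAut F2) : Prop := ∀ γ ∈ nielsen, autSize ψ ≤ autSize (ψ * γ)

variable {ψ : MulAut F2}

theorem autSize_eq_of_ne (ψ : MulAut F2) {p q : Fin 2 × Bool} (h : p.1 ≠ q.1) :
    (ψ (FreeGroup.mk [p])).norm + (ψ (FreeGroup.mk [q])).norm = autSize ψ := by
  have key : ∀ p : Fin 2 × Bool, (ψ (FreeGroup.mk [p])).norm = (ψ (FreeGroup.of p.1)).norm := by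
    rintro ⟨i, s⟩
    cases s
    · have : FreeGroup.mk [(i, false)] = (FreeGroup.of i)⁻¹ := rfl
      rw [this, map_inv, FreeGroup.norm_inv_eq]
    · rfl
  rw [key, key, autSize]
  rcases p with ⟨i, s⟩
  rcases q with ⟨j, t⟩
  fin_cases i <;> fin_cases j <;> simp at h ⊢
  exact add_comm _ _

/-- The competitor replaces `p` by `pq` and conjugates both images by `g`. The freedom in `g` serves
the half-cancellation case of `norm_triple_lt`. -/
theorem conj_size_le (hmin : NielsenMinimal ψ) {p q : Fin 2 × Bool} (h : p.1 ≠ q.1) (g : F2) :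
    (ψ (FreeGroup.mk [p])).norm + (ψ (FreeGroup.mk [q])).norm ≤
      (g * (ψ (FreeGroup.mk [p]) * ψ (FreeGroup.mk [q])) * g⁻¹).norm +
        (g * ψ (FreeGroup.mk [q]) * g⁻¹).norm := by
  obtain ⟨σ, hσ, h0, h1⟩ := exists_signedPerm h
  -- Conjugation by `ψ⁻¹ g` before `ψ` is conjugation by `g` after it.
  have := hmin (MulAut.conj (ψ⁻¹ g) * (σ * autU))
    (mul_mem (conj_mem _) (mul_mem (signedPerms_le_nielsen hσ) autU_mem))
  rw [autSize_eq_of_ne ψ h]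
  refine this.trans (le_of_eq ?_)
  simp [autSize, h0, h1, -FreeGroup.mul_mk]

theorem norm_left_le (hmin : NielsenMinimal ψ) {p q : Fin 2 × Bool} (h : NotCancel p q) :
    (ψ (FreeGroup.mk [p])).norm ≤ (ψ (FreeGroup.mk [p]) * ψ (FreeGroup.mk [q])).norm := by
  by_cases hpq : p.1 = q.1
  · have : p = q := Prod.ext hpq (h hpq)
    subst this
    refine (norm_lt_norm_mul_self ?_).le
    simpa using letter_ne_one p
  · have := conj_size_le hmin hpq 1
    simp only [one_mul, inv_one, mul_one] at this
    omega

theorem norm_right_le (hmin : NielsenMinimal ψ) {p q : Fin 2 × Bool} (h : NotCancel p q) :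
    (ψ (FreeGroup.mk [q])).norm ≤ (ψ (FreeGroup.mk [p]) * ψ (FreeGroup.mk [q])).norm := by
  have h' : NotCancel (q.1, !q.2) (p.1, !p.2) := fun e => by
    simp [h e.symm]
  have := norm_left_le hmin h'
  rw [mk_inv_letter, mk_inv_letter, map_inv, map_inv, ← mul_inv_rev, FreeGroup.norm_inv_eq,
    FreeGroup.norm_inv_eq] at this
  exact this

/-- The neighbours never consume the whole of `ψ(q)`. The only obstruction left by `norm_left_le`
and `norm_right_le` is that each neighbour cancels exactly half of it. The moves `p ↦ pq` shorten
nothing there, but a conjugation does. -/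
theorem norm_triple_lt (hmin : NielsenMinimal ψ) {p q r : Fin 2 × Bool} (h1 : NotCancel p q) (h2 : NotCancel q r) :
    (ψ (FreeGroup.mk [p])).norm + (ψ (FreeGroup.mk [r])).norm + 2 ≤
      (ψ (FreeGroup.mk [p]) * ψ (FreeGroup.mk [q])).norm +
        (ψ (FreeGroup.mk [q]) * ψ (FreeGroup.mk [r])).norm := by
  have hne : ∀ p : Fin 2 × Bool, ψ (FreeGroup.mk [p]) ≠ 1 := fun p => by
    simpa using letter_ne_one p
  -- The two sides have the same parity, so a strict inequality already gains 2.
  suffices hlt : (ψ (FreeGroup.mk [p])).norm + (ψ (FreeGroup.mk [r])).norm <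
      (ψ (FreeGroup.mk [p]) * ψ (FreeGroup.mk [q])).norm +
        (ψ (FreeGroup.mk [q]) * ψ (FreeGroup.mk [r])).norm by
    obtain ⟨k, hk⟩ := even_norm_mul (ψ (FreeGroup.mk [p])) (ψ (FreeGroup.mk [q]))
    obtain ⟨l, hl⟩ := even_norm_mul (ψ (FreeGroup.mk [q])) (ψ (FreeGroup.mk [r]))
    omega
  have l1 := norm_left_le hmin h1
  have l2 := norm_right_le hmin h2
  have l3 := norm_right_le hmin h1
  by_contra hcon
  have e1 : (ψ (FreeGroup.mk [p]) * ψ (FreeGroup.mk [q])).norm = (ψ (FreeGroup.mk [p])).norm := by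
    omega
  have e2 : (ψ (FreeGroup.mk [q]) * ψ (FreeGroup.mk [r])).norm = (ψ (FreeGroup.mk [r])).norm := by
    omega
  have hpq : p.1 ≠ q.1 := by
    intro h
    have : p = q := Prod.ext h (h1 h)
    subst this
    exact absurd (norm_lt_norm_mul_self (hne p)) (by omega)
  have hqr : q.1 ≠ r.1 := by
    intro h
    have : q = r := Prod.ext h (h2 h)
    subst this
    exact absurd (norm_lt_norm_mul_self (hne q)) (by omega)
  have hpr : p.1 = r.1 := by omega
  have hconj := fun g => conj_size_le hmin hpq g
  have hQ := hne q
  have hr : ψ (FreeGroup.mk [r]) = ψ (FreeGroup.mk [p]) ∨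
      ψ (FreeGroup.mk [r]) = (ψ (FreeGroup.mk [p]))⁻¹ := by
    by_cases h : p.2 = r.2
    · left; rw [show p = r from Prod.ext hpr h]
    · right
      rw [← map_inv, ← mk_inv_letter]
      rw [show r = (p.1, !p.2) from Prod.ext hpr.symm (by
        revert h; cases p.2 <;> cases r.2 <;> simp)]
  generalize ψ (FreeGroup.mk [p]) = P at *
  generalize ψ (FreeGroup.mk [q]) = Q at *
  generalize ψ (FreeGroup.mk [r]) = R at *
  have hQ0 : 0 < Q.norm := by
    rw [Nat.pos_iff_ne_zero, ne_eq, FreeGroup.norm_eq_zero]; exact hQ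
  obtain ⟨u, c, v, hP, hQ1, hPQ⟩ := exists_cancellation_mul P Q
  obtain ⟨v', d, w, hQ2, hR, hQR⟩ := exists_cancellation_mul Q R
  have n1 : P.norm = u.length + c.length := by simp [FreeGroup.norm, hP]
  have n2 : Q.norm = c.length + v.length := by simp [FreeGroup.norm, hQ1]
  have n2' : Q.norm = v'.length + d.length := by simp [FreeGroup.norm, hQ2]
  have n3 : R.norm = d.length + w.length := by simp [FreeGroup.norm, hR]
  have n4 : (P * Q).norm = u.length + v.length := by simp [FreeGroup.norm, hPQ]
  have n5 : (Q * R).norm = v'.length + w.length := by simp [FreeGroup.norm, hQR]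
  obtain ⟨hcv, hvd⟩ := List.append_inj (hQ1.symm.trans hQ2) (by omega)
  subst hcv
  have hQe : Q = FreeGroup.mk c * (FreeGroup.mk d)⁻¹ := by
    rw [← FreeGroup.mk_toWord (x := Q), hQ2, FreeGroup.inv_mk, FreeGroup.mul_mk]
  rcases hr with rfl | rfl
  -- The outer letters have the same image `d m c⁻¹`, and `Q = c d⁻¹`. Conjugating the pair formed
  -- by their product and `Q` by `d⁻¹` gives `m` and `d⁻¹c`, shorter in total than the original pair
  -- by at least `|Q| > 0`.
  · obtain ⟨m, rfl⟩ : ∃ m, u = d ++ m := by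
      have : d <+: u := List.prefix_of_prefix_length_le (l₃ := R.toWord) ⟨_, hR.symm⟩
        ⟨_, hP.symm⟩ (by omega)
      obtain ⟨m, hm⟩ := this
      exact ⟨m, hm.symm⟩
    have hRe : R = FreeGroup.mk d * FreeGroup.mk m * (FreeGroup.mk c)⁻¹ := by
      rw [← FreeGroup.mk_toWord (x := R), hP, FreeGroup.inv_mk, FreeGroup.mul_mk, FreeGroup.mul_mk]
    have := hconj (FreeGroup.mk d)⁻¹
    have t1 : (FreeGroup.mk d)⁻¹ * (R * Q) * (FreeGroup.mk d)⁻¹⁻¹ = FreeGroup.mk m := by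
      rw [hRe, hQe]; group
    have t2 : (FreeGroup.mk d)⁻¹ * Q * (FreeGroup.mk d)⁻¹⁻¹ =
        FreeGroup.mk (FreeGroup.invRev d ++ c) := by
      rw [hQe, ← FreeGroup.mul_mk, ← FreeGroup.inv_mk]; group
    rw [t1, t2] at this
    have b1 := FreeGroup.norm_mk_le (L₁ := m)
    have b2 := FreeGroup.norm_mk_le (L₁ := FreeGroup.invRev d ++ c)
    simp only [List.length_append, FreeGroup.invRev_length] at b2 n1
    omega
  -- The third image is now `P⁻¹`, which begins with both `c` and `d`; these have equal length, so
  -- `Q = 1`.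
  · rw [FreeGroup.toWord_inv, hP, FreeGroup.invRev_append, FreeGroup.invRev_invRev] at hR
    obtain ⟨hcd, -⟩ := List.append_inj hR (by omega)
    apply hQ
    rw [hQe, hcd]
    group

theorem map_cons_letter (ψ : MulAut F2) (p : Fin 2 × Bool) (L : List (Fin 2 × Bool)) :
    ψ (FreeGroup.mk (p :: L)) = ψ (FreeGroup.mk [p]) * ψ (FreeGroup.mk L) := by
  rw [← map_mul, FreeGroup.mul_mk, List.singleton_append]

theorem norm_map_cons_cons (hmin : NielsenMinimal ψ) (p q : Fin 2 × Bool) (L : List (Fin 2 × Bool))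
    (h : FreeGroup.IsReduced (p :: q :: L)) :
    (ψ (FreeGroup.mk (p :: q :: L))).norm + (ψ (FreeGroup.mk [q])).norm =
      (ψ (FreeGroup.mk [p]) * ψ (FreeGroup.mk [q])).norm + (ψ (FreeGroup.mk (q :: L))).norm := by
  induction L generalizing p q with
  | nil => rw [map_cons_letter ψ p [q]]
  | cons r L ih =>
    have hpq : NotCancel p q := (List.isChain_cons_cons.1 h).1
    have h' : FreeGroup.IsReduced (q :: r :: L) := (List.isChain_cons_cons.1 h).2
    have hqr : NotCancel q r := (List.isChain_cons_cons.1 h').1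
    have := ih q r h'
    have t := norm_triple_lt hmin hpq hqr
    rw [map_cons_letter ψ p, map_cons_letter ψ q]
    rw [map_cons_letter ψ q] at this
    rw [← mul_assoc]
    exact norm_mul_mul _ _ _ (by omega)

/-- Each letter leaves at least one letter of its image uncancelled. Lengths are doubled and the
cancellation with the preceding letter `p` is kept as a boundary term so that the induction closes.
-/
theorem length_add_le (hmin : NielsenMinimal ψ) (p q : Fin 2 × Bool) (L : List (Fin 2 × Bool))
    (h : FreeGroup.IsReduced (p :: q :: L)) :
    2 * (q :: L).length + (ψ (FreeGroup.mk [p])).norm + (ψ (FreeGroup.mk [q])).norm ≤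
      2 * (ψ (FreeGroup.mk (q :: L))).norm +
        (ψ (FreeGroup.mk [p]) * ψ (FreeGroup.mk [q])).norm := by
  induction L generalizing p q with
  | nil =>
    have hpq : NotCancel p q := (List.isChain_cons_cons.1 h).1
    have t := norm_left_le hmin hpq
    obtain ⟨k, hk⟩ := even_norm_mul (ψ (FreeGroup.mk [p])) (ψ (FreeGroup.mk [q]))
    have : (ψ (FreeGroup.mk [q])).norm ≠ 0 := by
      rw [ne_eq, FreeGroup.norm_eq_zero]
      simpa using letter_ne_one q
    simp only [List.length_singleton]
    omega
  | cons r L ih =>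
    have hpq : NotCancel p q := (List.isChain_cons_cons.1 h).1
    have h' : FreeGroup.IsReduced (q :: r :: L) := (List.isChain_cons_cons.1 h).2
    have hqr : NotCancel q r := (List.isChain_cons_cons.1 h').1
    have := ih q r h'
    have t := norm_triple_lt hmin hpq hqr
    have e := norm_map_cons_cons hmin q r L h'
    simp only [List.length_cons] at this ⊢
    omega

theorem norm_le_norm_map (hmin : NielsenMinimal ψ) (g : F2) : g.norm ≤ (ψ g).norm := by
  rw [← FreeGroup.mk_toWord (x := g)]
  have hred := FreeGroup.isReduced_toWord (x := g)
  revert hred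
  rcases g.toWord with _ | ⟨p, L⟩ <;> intro hred
  · simp [← FreeGroup.one_eq_mk]
  -- The first letter is repeated as a phantom predecessor; `|ψ(p)ψ(p)| ≤ 2|ψ(p)|` then removes the
  -- boundary terms.
  · have := length_add_le hmin p p L (List.isChain_cons_cons.2 ⟨fun _ => rfl, hred⟩)
    have t := FreeGroup.norm_mul_le (ψ (FreeGroup.mk [p])) (ψ (FreeGroup.mk [p]))
    rw [norm_eq_of_isReduced hred]
    omega

/-- Since `ψ` does not shorten words, the preimages of the generators are single letters, so `ψ⁻¹`
is a signed permutation. -/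
theorem mem_nielsen_of_minimal (hmin : NielsenMinimal ψ) : ψ ∈ nielsen := by
  have hlet : ∀ i : Fin 2, ∃ p, ψ⁻¹ (FreeGroup.of i) = FreeGroup.mk [p] := by
    intro i
    have h1 := norm_le_norm_map hmin (ψ⁻¹ (FreeGroup.of i))
    rw [MulAut.apply_inv_self, FreeGroup.norm_of] at h1
    have h2 : (ψ⁻¹ (FreeGroup.of i)).norm ≠ 0 := by
      rw [ne_eq, FreeGroup.norm_eq_zero]
      simp
    obtain ⟨p, hp⟩ := List.length_eq_one_iff.1 (show (ψ⁻¹ (FreeGroup.of i)).toWord.length = 1 by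
      rw [FreeGroup.norm] at h1 h2; omega)
    exact ⟨p, by rw [← hp, FreeGroup.mk_toWord]⟩
  obtain ⟨p, hp⟩ := hlet 0
  obtain ⟨q, hq⟩ := hlet 1
  have hpq : p.1 ≠ q.1 := by
    intro h
    by_cases h2 : p.2 = q.2
    · have : ψ⁻¹ (FreeGroup.of 0) = ψ⁻¹ (FreeGroup.of 1) := by
        rw [hp, hq, show p = q from Prod.ext h h2]
      simpa using FreeGroup.of_injective ((ψ⁻¹).injective this)
    · have : ψ⁻¹ (FreeGroup.of 0) = ψ⁻¹ (FreeGroup.of 1)⁻¹ := by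
        rw [map_inv, hp, hq, ← mk_inv_letter]
        rw [show p = (q.1, !q.2) from Prod.ext h (by
          revert h2; cases p.2 <;> cases q.2 <;> simp)]
      have h3 := congrArg FreeGroup.toWord ((ψ⁻¹).injective this)
      simp [FreeGroup.toWord_inv, FreeGroup.invRev] at h3
  obtain ⟨σ, hσ, h0, h1⟩ := exists_signedPerm hpq
  have : ψ⁻¹ = σ := mulAut_ext (by rw [hp, h0]) (by rw [hq, h1])
  rw [← inv_mem_iff, this]
  exact signedPerms_le_nielsen hσ

end Minimal

/-- **Nielsen's theorem** in rank two. -/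
theorem nielsen_eq_top : nielsen = ⊤ := by
  rw [eq_top_iff]
  intro φ _
  let P : ℕ → Prop := fun n => ∃ γ ∈ nielsen, autSize (φ * γ) = n
  have hP : ∃ n, P n := ⟨_, 1, one_mem _, rfl⟩
  classical
  obtain ⟨γ, hγ, hn⟩ := Nat.find_spec hP
  have hmin : NielsenMinimal (φ * γ) := by
    intro δ hδ
    rw [hn]
    exact Nat.find_min' hP ⟨γ * δ, mul_mem hγ hδ, by rw [mul_assoc]⟩
  exact (mul_mem_cancel_right hγ).1 (mem_nielsen_of_minimal hmin)

end Nielsen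

/-! ### A normal form for outer automorphisms -/

section NormalForm

/-- In a group with the relations of `GL₂(ℤ)`, each element is the product of a signed permutation
and a word in the two transvections or in their inverses. -/
theorem exists_normalForm {H : Type*} [Group H] {S E U L : H} (hS : S * S = 1) (hE : E * E = 1)
    (hL : S * U * S = L) (hEU : E * U * E = U⁻¹) (hEL : E * L * E = L⁻¹)
    (hUL : U⁻¹ * L = S * E * U) {h : H} (hh : h ∈ Subgroup.closure {S, E, U}) :
    ∃ σ ∈ Subgroup.closure {S, E}, ∃ π, h = σ * π ∧
      (π ∈ Submonoid.closure {U, L} ∨ π ∈ Submonoid.closure {U⁻¹, L⁻¹}) := by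
  have hSinv : S⁻¹ = S := inv_eq_of_mul_eq_one_right hS
  have hEinv : E⁻¹ = E := inv_eq_of_mul_eq_one_right hE
  have mS : S ∈ Subgroup.closure {S, E} := Subgroup.subset_closure (by simp)
  have mE : E ∈ Subgroup.closure {S, E} := Subgroup.subset_closure (by simp)
  have hSS : ∀ x, S * (S * x) = x := fun x => by rw [← mul_assoc, hS, one_mul]
  have hEE : ∀ x, E * (E * x) = x := fun x => by rw [← mul_assoc, hE, one_mul]
  have hU : S * L * S = U := by rw [← hL]; simp only [mul_assoc, hSS, hS, mul_one]
  have hUS : S * U⁻¹ * S = L⁻¹ := by rw [← hL]; simp only [mul_inv_rev, hSinv, mul_assoc]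
  have hLS : S * L⁻¹ * S = U⁻¹ := by rw [← hU]; simp only [mul_inv_rev, hSinv, mul_assoc]
  have hEU' : E * U⁻¹ * E = U := by rw [← hEU]; simp only [mul_assoc, hEE, hE, mul_one]
  have hEL' : E * L⁻¹ * E = L := by rw [← hEL]; simp only [mul_assoc, hEE, hE, mul_one]
  -- This and the next two relations are `hUL` conjugated by `S` and `E`.
  have hLU : L⁻¹ * U = E * S * L := by
    calc L⁻¹ * U = (S * U⁻¹ * S) * (S * L * S) := by rw [hUS, hU]
      _ = S * (U⁻¹ * L) * S := by simp only [mul_assoc, hSS]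
      _ = E * S * (S * U * S) := by rw [hUL]; simp only [mul_assoc, hSS]
      _ = E * S * L := by rw [hL]
  have hUL' : U * L⁻¹ = E * S * U⁻¹ := by
    calc U * L⁻¹ = (E * U⁻¹ * E) * (E * L * E) := by rw [hEU', hEL]
      _ = E * (U⁻¹ * L) * E := by simp only [mul_assoc, hEE]
      _ = E * S * (E * U * E) := by rw [hUL]; simp only [mul_assoc]
      _ = E * S * U⁻¹ := by rw [hEU]
  have hLU' : L * U⁻¹ = S * E * L⁻¹ := by
    calc L * U⁻¹ = (E * L⁻¹ * E) * (E * U * E) := by rw [hEU, hEL']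
      _ = E * (L⁻¹ * U) * E := by simp only [mul_assoc, hEE]
      _ = S * E * (E * L * E) := by rw [hLU]; simp only [mul_assoc, hEE]
      _ = S * E * L⁻¹ := by rw [hEL]
  -- Conjugation by signed permutations permutes the four transvections, so signed permutations can
  -- be collected on the left.
  have hconj : ∀ σ ∈ Subgroup.closure {S, E}, ∀ X ∈ ({U, L, U⁻¹, L⁻¹} : Set H),
      ∃ Y ∈ ({U, L, U⁻¹, L⁻¹} : Set H), X * σ = σ * Y := by
    have hgen : ∀ σ ∈ ({S, E} : Set H), ∀ X ∈ ({U, L, U⁻¹, L⁻¹} : Set H),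
        ∃ Y ∈ ({U, L, U⁻¹, L⁻¹} : Set H), X * σ = σ * Y := by
      intro σ hσ X hX
      refine ⟨σ⁻¹ * X * σ, ?_, by group⟩
      simp only [Set.mem_insert_iff, Set.mem_singleton_iff] at hσ hX
      rcases hσ with rfl | rfl <;> rcases hX with rfl | rfl | rfl | rfl <;>
        simp only [hSinv, hEinv, hL, hU, hUS, hLS, hEU, hEL, hEU', hEL'] <;> simp
    intro σ hσ
    induction hσ using Subgroup.closure_induction_left with
    | one => intro X hX; exact ⟨X, hX, by simp⟩
    | mul_left x hx y hy ih =>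
      intro X hX
      obtain ⟨Y, hY, e⟩ := hgen x hx X hX
      obtain ⟨Z, hZ, e'⟩ := ih Y hY
      exact ⟨Z, hZ, by rw [← mul_assoc, e, mul_assoc, e', mul_assoc]⟩
    | inv_mul_cancel x hx y hy ih =>
      intro X hX
      have hx' : x⁻¹ = x := by
        simp only [Set.mem_insert_iff, Set.mem_singleton_iff] at hx
        rcases hx with rfl | rfl
        · exact hSinv
        · exact hEinv
      obtain ⟨Y, hY, e⟩ := hgen x hx X hX
      obtain ⟨Z, hZ, e'⟩ := ih Y hY
      exact ⟨Z, hZ, by rw [hx', ← mul_assoc, e, mul_assoc, e', mul_assoc]⟩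
  have hcasesP : ∀ π ∈ Submonoid.closure {U, L}, π = 1 ∨ ∃ π' ∈ Submonoid.closure {U, L},
      π = U * π' ∨ π = L * π' := by
    intro π hπ
    induction hπ using Submonoid.closure_induction_left with
    | one => exact Or.inl rfl
    | mul_left x hx y hy _ =>
      refine Or.inr ⟨y, hy, ?_⟩
      simp only [Set.mem_insert_iff, Set.mem_singleton_iff] at hx
      rcases hx with rfl | rfl <;> simp
  have hcasesQ : ∀ π ∈ Submonoid.closure {U⁻¹, L⁻¹}, π = 1 ∨
      ∃ π' ∈ Submonoid.closure {U⁻¹, L⁻¹}, π = U⁻¹ * π' ∨ π = L⁻¹ * π' := by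
    intro π hπ
    induction hπ using Submonoid.closure_induction_left with
    | one => exact Or.inl rfl
    | mul_left x hx y hy _ =>
      refine Or.inr ⟨y, hy, ?_⟩
      simp only [Set.mem_insert_iff, Set.mem_singleton_iff] at hx
      rcases hx with rfl | rfl <;> simp
  have mU : U ∈ Submonoid.closure {U, L} := Submonoid.subset_closure (by simp)
  have mL : L ∈ Submonoid.closure {U, L} := Submonoid.subset_closure (by simp)
  have mU' : U⁻¹ ∈ Submonoid.closure {U⁻¹, L⁻¹} := Submonoid.subset_closure (by simp)
  have mL' : L⁻¹ ∈ Submonoid.closure {U⁻¹, L⁻¹} := Submonoid.subset_closure (by simp)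
  -- A factor of the wrong sign either cancels against the first factor of `π` or is absorbed by a
  -- mixed relation such as `U⁻¹L = SEU`, which leaves only a signed permutation in front.
  have hstep : ∀ X ∈ ({U, L, U⁻¹, L⁻¹} : Set H), ∀ π,
      (π ∈ Submonoid.closure {U, L} ∨ π ∈ Submonoid.closure {U⁻¹, L⁻¹}) →
      ∃ σ ∈ Subgroup.closure {S, E}, ∃ π', X * π = σ * π' ∧
        (π' ∈ Submonoid.closure {U, L} ∨ π' ∈ Submonoid.closure {U⁻¹, L⁻¹}) := by
    intro X hX π hπ
    simp only [Set.mem_insert_iff, Set.mem_singleton_iff] at hX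
    rcases hπ with hπ | hπ
    · rcases hX with rfl | rfl | rfl | rfl
      · exact ⟨1, one_mem _, _, (one_mul _).symm, Or.inl (mul_mem mU hπ)⟩
      · exact ⟨1, one_mem _, _, (one_mul _).symm, Or.inl (mul_mem mL hπ)⟩
      · rcases hcasesP π hπ with rfl | ⟨π', hπ', rfl | rfl⟩
        · exact ⟨1, one_mem _, _, (one_mul _).symm, Or.inr (by simpa using mU')⟩
        · exact ⟨1, one_mem _, π', by simp, Or.inl hπ'⟩
        · exact ⟨S * E, mul_mem mS mE, U * π', by rw [← mul_assoc, hUL]; simp only [mul_assoc],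
            Or.inl (mul_mem mU hπ')⟩
      · rcases hcasesP π hπ with rfl | ⟨π', hπ', rfl | rfl⟩
        · exact ⟨1, one_mem _, _, (one_mul _).symm, Or.inr (by simpa using mL')⟩
        · exact ⟨E * S, mul_mem mE mS, L * π', by rw [← mul_assoc, hLU]; simp only [mul_assoc],
            Or.inl (mul_mem mL hπ')⟩
        · exact ⟨1, one_mem _, π', by simp, Or.inl hπ'⟩
    · rcases hX with rfl | rfl | rfl | rfl
      · rcases hcasesQ π hπ with rfl | ⟨π', hπ', rfl | rfl⟩
        · exact ⟨1, one_mem _, _, (one_mul _).symm, Or.inl (by simpa using mU)⟩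
        · exact ⟨1, one_mem _, π', by simp, Or.inr hπ'⟩
        · exact ⟨E * S, mul_mem mE mS, X⁻¹ * π', by rw [← mul_assoc, hUL']; simp only [mul_assoc],
            Or.inr (mul_mem mU' hπ')⟩
      · rcases hcasesQ π hπ with rfl | ⟨π', hπ', rfl | rfl⟩
        · exact ⟨1, one_mem _, _, (one_mul _).symm, Or.inl (by simpa using mL)⟩
        · exact ⟨S * E, mul_mem mS mE, X⁻¹ * π', by rw [← mul_assoc, hLU']; simp only [mul_assoc],
            Or.inr (mul_mem mL' hπ')⟩
        · exact ⟨1, one_mem _, π', by simp, Or.inr hπ'⟩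
      · exact ⟨1, one_mem _, _, (one_mul _).symm, Or.inr (mul_mem mU' hπ)⟩
      · exact ⟨1, one_mem _, _, (one_mul _).symm, Or.inr (mul_mem mL' hπ)⟩
  have hmulU : ∀ X ∈ ({U, L, U⁻¹, L⁻¹} : Set H), ∀ y, (∃ σ ∈ Subgroup.closure {S, E}, ∃ π,
      y = σ * π ∧ (π ∈ Submonoid.closure {U, L} ∨ π ∈ Submonoid.closure {U⁻¹, L⁻¹})) →
      ∃ σ ∈ Subgroup.closure {S, E}, ∃ π, X * y = σ * π ∧
        (π ∈ Submonoid.closure {U, L} ∨ π ∈ Submonoid.closure {U⁻¹, L⁻¹}) := by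
    rintro X hX y ⟨σ, hσ, π, rfl, hπ⟩
    obtain ⟨Y, hY, e⟩ := hconj σ hσ X hX
    obtain ⟨σ', hσ', π', e', hπ'⟩ := hstep Y hY π hπ
    exact ⟨σ * σ', mul_mem hσ hσ', π', by rw [← mul_assoc, e, mul_assoc, e', mul_assoc], hπ'⟩
  induction hh using Subgroup.closure_induction_left with
  | one => exact ⟨1, one_mem _, 1, by simp, Or.inl (one_mem _)⟩
  | mul_left x hx y hy ih =>
    simp only [Set.mem_insert_iff, Set.mem_singleton_iff] at hx
    rcases hx with rfl | rfl | rfl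
    · obtain ⟨σ, hσ, π, rfl, hπ⟩ := ih
      exact ⟨x * σ, mul_mem mS hσ, π, (mul_assoc _ _ _).symm, hπ⟩
    · obtain ⟨σ, hσ, π, rfl, hπ⟩ := ih
      exact ⟨x * σ, mul_mem mE hσ, π, (mul_assoc _ _ _).symm, hπ⟩
    · exact hmulU x (by simp) y ih
  | inv_mul_cancel x hx y hy ih =>
    simp only [Set.mem_insert_iff, Set.mem_singleton_iff] at hx
    rcases hx with rfl | rfl | rfl
    · obtain ⟨σ, hσ, π, rfl, hπ⟩ := ih
      exact ⟨x⁻¹ * σ, mul_mem (inv_mem mS) hσ, π, (mul_assoc _ _ _).symm, hπ⟩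
    · obtain ⟨σ, hσ, π, rfl, hπ⟩ := ih
      exact ⟨x⁻¹ * σ, mul_mem (inv_mem mE) hσ, π, (mul_assoc _ _ _).symm, hπ⟩
    · exact hmulU x⁻¹ (by simp) y ih

/-- The action of the automorphisms of a group on its conjugacy classes. -/
def conjClassesPerm (G : Type*) [Group G] : MulAut G →* Equiv.Perm (ConjClasses G) where
  toFun φ :=
    { toFun := ConjClasses.map φ.toMonoidHom
      invFun := ConjClasses.map φ⁻¹.toMonoidHom
      left_inv := by
        rintro ⟨x⟩
        exact congrArg ConjClasses.mk (MulAut.inv_apply_self G φ x)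
      right_inv := by
        rintro ⟨x⟩
        exact congrArg ConjClasses.mk (MulAut.apply_inv_self G φ x) }
  map_one' := by
    ext ⟨x⟩
    rfl
  map_mul' φ ψ := by
    ext ⟨x⟩
    rfl

@[simp] theorem conjClassesPerm_mk {G : Type*} [Group G] (φ : MulAut G) (g : G) :
    conjClassesPerm G φ (ConjClasses.mk g) = ConjClasses.mk (φ g) := rfl

theorem conjClassesPerm_conj {G : Type*} [Group G] (g : G) :
    conjClassesPerm G (MulAut.conj g) = 1 := by
  ext x
  rcases x with ⟨x⟩
  change ConjClasses.mk (MulAut.conj g x) = ConjClasses.mk x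
  rw [ConjClasses.mk_eq_mk_iff_isConj, isConj_comm, isConj_iff]
  exact ⟨g, rfl⟩

/-- Inner automorphisms act trivially on conjugacy classes, so the relations of `GL₂(ℤ)`, some of
which hold in `Aut(F₂)` only up to inner automorphisms, become exact in the image of
`conjClassesPerm`. -/
theorem exists_conj_normalForm (φ : MulAut F2) :
    ∃ σ ∈ signedPerms, ∃ π, (∀ g, IsConj (φ g) (σ (π g))) ∧
      (π ∈ Submonoid.closure {autU, autL} ∨ π ∈ Submonoid.closure {autU⁻¹, autL⁻¹}) := by
  set ρ := conjClassesPerm F2 with hρ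
  have hφ : ρ φ ∈ Subgroup.closure {ρ autSwap, ρ autInv, ρ autU} := by
    have h1 : φ ∈ nielsen := nielsen_eq_top ▸ Subgroup.mem_top φ
    have h2 : nielsen ≤ (Subgroup.closure {ρ autSwap, ρ autInv, ρ autU}).comap ρ := by
      rw [nielsen, Subgroup.closure_le]
      rintro x (hx | ⟨g, rfl⟩)
      · simp only [Set.mem_insert_iff, Set.mem_singleton_iff] at hx
        refine Subgroup.subset_closure ?_
        rcases hx with rfl | rfl | rfl <;> simp
      · change ρ (MulAut.conj g) ∈ Subgroup.closure {ρ autSwap, ρ autInv, ρ autU}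
        rw [hρ, conjClassesPerm_conj]
        exact one_mem _
    exact h2 h1
  have hS : autSwap * autSwap = 1 := mulAut_ext (by simp) (by simp)
  have hE : autInv * autInv = 1 := mulAut_ext (by simp) (by simp)
  have hL : autSwap * autU * autSwap = autL := mulAut_ext (by simp) (by simp)
  have hEU : autInv * autU * autInv = MulAut.conj (FreeGroup.of 1)⁻¹ * autU⁻¹ :=
    mulAut_ext (by simp [mul_assoc]) (by simp)
  have hEL : autInv * autL * autInv = autL⁻¹ := mulAut_ext (by simp) (by simp)
  have hUL : MulAut.conj (FreeGroup.of 1)⁻¹ * (autU⁻¹ * autL) = autSwap * autInv * autU :=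
    mulAut_ext (by simp [mul_assoc]) (by simp [mul_assoc])
  obtain ⟨σ, hσ, π, e, hπ⟩ := exists_normalForm (S := ρ autSwap) (E := ρ autInv) (U := ρ autU)
    (L := ρ autL) (by rw [← map_mul, hS, map_one]) (by rw [← map_mul, hE, map_one])
    (by rw [← map_mul, ← map_mul, hL])
    (by rw [← map_mul, ← map_mul, hEU, map_mul, hρ, conjClassesPerm_conj, one_mul, map_inv])
    (by rw [← map_mul, ← map_mul, hEL, map_inv])
    (by rw [← map_mul, ← map_mul, ← hUL, map_mul, hρ, conjClassesPerm_conj, one_mul, map_mul,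
      map_inv]) hφ
  have hσ' : σ ∈ signedPerms.map ρ := by
    rw [signedPerms, MonoidHom.map_closure]
    convert hσ using 2
    simp [Set.image_pair]
  obtain ⟨σ, hσs, rfl⟩ := hσ'
  have hπ' : ∃ π', (π' ∈ Submonoid.closure {autU, autL} ∨
      π' ∈ Submonoid.closure {autU⁻¹, autL⁻¹}) ∧ ρ π' = π := by
    rcases hπ with hπ | hπ
    · have : π ∈ (Submonoid.closure {autU, autL}).map ρ := by
        rw [MonoidHom.map_mclosure]
        convert hπ using 2
        simp [Set.image_pair]
      obtain ⟨π', h, rfl⟩ := this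
      exact ⟨π', Or.inl h, rfl⟩
    · have : π ∈ (Submonoid.closure {autU⁻¹, autL⁻¹}).map ρ := by
        rw [MonoidHom.map_mclosure]
        convert hπ using 2
        simp [Set.image_pair]
      obtain ⟨π', h, rfl⟩ := this
      exact ⟨π', Or.inr h, rfl⟩
  obtain ⟨π', hπ', rfl⟩ := hπ'
  refine ⟨σ, hσs, π', fun g => ?_, hπ'⟩
  have := congrArg (fun p => p (ConjClasses.mk g)) e
  rw [← ConjClasses.mk_eq_mk_iff_isConj]
  simpa [hρ] using this

end NormalForm

/-! ### Cyclic words as sequences of runs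

A pair `(ε, k)` stands for the block `b^ε a^k`. -/

section Runs

/-- The element represented by a sequence of runs. -/
def prodRuns (W : List (Bool × ℤ)) : F2 :=
  (W.map fun p => FreeGroup.mk [(1, p.1)] * FreeGroup.of 0 ^ p.2).prod

@[simp] theorem prodRuns_nil : prodRuns [] = 1 := rfl

@[simp] theorem prodRuns_cons (p : Bool × ℤ) (W : List (Bool × ℤ)) :
    prodRuns (p :: W) = FreeGroup.mk [(1, p.1)] * FreeGroup.of 0 ^ p.2 * prodRuns W := by
  simp [prodRuns]

theorem prodRuns_append (W W' : List (Bool × ℤ)) :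
    prodRuns (W ++ W') = prodRuns W * prodRuns W' := by
  simp [prodRuns]

/-- The condition with parameter `N` on the exponent of `a` between two consecutive letters
`b^{±1}`. -/
def RunRel (N : ℕ) (p q : Bool × ℤ) : Prop :=
  if p.1 then (if q.1 then -(N + 1 : ℤ) ≤ p.2 else 1 ≤ p.2)
  else (if q.1 then 1 ≤ p.2 else (N : ℤ) ≤ p.2)

/-- Elements whose cyclic reduction does not contain `b⁻¹`. -/
def NoNegB (g : F2) : Prop :=
  (∃ k : ℤ, IsConj g (FreeGroup.of 0 ^ k)) ∨
    ∃ W : List (Bool × ℤ), (∀ p ∈ W, p.1 = true) ∧ IsConj g (prodRuns W)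

/-- Elements conjugate to a cyclic sequence of runs satisfying `RunRel N`. -/
def RunClass (N : ℕ) (g : F2) : Prop :=
  ∃ W : List (Bool × ℤ), W ≠ [] ∧ Cycle.Chain (RunRel N) (W : Cycle (Bool × ℤ)) ∧
    IsConj g (prodRuns W)

/-- A class of elements that contains the positive ones and is preserved by `autU⁻¹` and
`autL⁻¹`. -/
def MixedClass (g : F2) : Prop :=
  NoNegB g ∨ NoNegB (autSwap g) ∨ (∃ N, RunClass (N + 1) g) ∨ ∃ N, RunClass (N + 1) (autSwap g)

theorem NoNegB.of_isConj {g h : F2} (hg : NoNegB g) (hc : IsConj h g) : NoNegB h := by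
  rcases hg with ⟨k, hk⟩ | ⟨W, hW, hk⟩
  · exact Or.inl ⟨k, hc.trans hk⟩
  · exact Or.inr ⟨W, hW, hc.trans hk⟩

theorem RunClass.of_isConj {N : ℕ} {g h : F2} (hg : RunClass N g) (hc : IsConj h g) :
    RunClass N h := by
  obtain ⟨W, h1, h2, h3⟩ := hg
  exact ⟨W, h1, h2, hc.trans h3⟩

theorem isConj_map_aut (φ : MulAut F2) {g h : F2} (hc : IsConj g h) : IsConj (φ g) (φ h) :=
  φ.toMonoidHom.map_isConj hc

theorem MixedClass.of_isConj {g h : F2} (hg : MixedClass g) (hc : IsConj h g) : MixedClass h := by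
  have hc' := isConj_map_aut autSwap hc
  rcases hg with hg | hg | ⟨N, hg⟩ | ⟨N, hg⟩
  · exact Or.inl (hg.of_isConj hc)
  · exact Or.inr (Or.inl (hg.of_isConj hc'))
  · exact Or.inr (Or.inr (Or.inl ⟨N, hg.of_isConj hc⟩))
  · exact Or.inr (Or.inr (Or.inr ⟨N, hg.of_isConj hc'⟩))

theorem autSwap_autSwap (g : F2) : autSwap (autSwap g) = g := by
  have : autSwap * autSwap = 1 := mulAut_ext (by simp) (by simp)
  rw [← MulAut.mul_apply, this, MulAut.one_apply]

theorem MixedClass.swap {g : F2} (hg : MixedClass g) : MixedClass (autSwap g) := by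
  unfold MixedClass at *
  rw [autSwap_autSwap]
  tauto

/-! #### The action of `b ↦ ba⁻¹` on runs -/

/-- The sign of the first run, or `c` for the empty sequence. -/
def headSign (c : Bool) : List (Bool × ℤ) → Bool
  | [] => c
  | p :: _ => p.1

/-- `1` for the sign of `b⁻¹`, and `0` for the sign of `b`. -/
def negCount (ε : Bool) : ℤ := if ε then 0 else 1

/-- The effect of `b ↦ ba⁻¹` on a sequence of runs followed by a run of sign `c`. -/
def shiftRuns (c : Bool) : List (Bool × ℤ) → List (Bool × ℤ)
  | [] => []
  | p :: W => (p.1, p.2 - 1 + negCount p.1 + negCount (headSign c W)) :: shiftRuns c W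

/-- `b⁻¹` becomes `ab⁻¹`, and the new `a` joins the preceding run. The outer powers of `a` are the
boundary effect; they form a conjugation when `c` is the sign of the first run. -/
theorem autL_symm_prodRuns (c : Bool) (W : List (Bool × ℤ)) :
    MulEquiv.symm autL (prodRuns W) = FreeGroup.of 0 ^ negCount (headSign c W) *
      prodRuns (shiftRuns c W) * FreeGroup.of 0 ^ (-negCount c) := by
  induction W with
  | nil => simp [shiftRuns, headSign]
  | cons p W ih =>
    rcases p with ⟨ε, k⟩
    have of_true : FreeGroup.mk [((1 : Fin 2), true)] = FreeGroup.of 1 := rfl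
    have of_false : FreeGroup.mk [((1 : Fin 2), false)] = (FreeGroup.of 1)⁻¹ := rfl
    rw [prodRuns_cons, map_mul, ih]
    cases ε
    · simp only [shiftRuns, headSign, negCount, of_false, map_mul, map_inv, map_zpow,
        autL_symm_one, autL_symm_zero, prodRuns_cons]
      simp only [Bool.false_eq_true, if_false, mul_inv_rev, inv_inv, zpow_add, zpow_sub, mul_assoc]
      simp
    · simp only [shiftRuns, headSign, negCount, of_true, map_mul, map_zpow,
        autL_symm_one, autL_symm_zero, prodRuns_cons]
      simp only [if_true, zpow_zero, add_zero, zpow_add, mul_assoc, zpow_sub, zpow_one, one_mul]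
      have : ∀ x : F2, FreeGroup.of 0 ^ k * ((FreeGroup.of 0)⁻¹ * x) =
        (FreeGroup.of 0)⁻¹ * (FreeGroup.of 0 ^ k * x) := fun x => by
          group
      rw [this]

/-- The exponent of `a` drops by one between two letters `b`, grows by one between two letters
`b⁻¹`, and is unchanged between opposite signs. This is the passage from `N` to `N + 1` in `RunRel`.
-/
theorem isChain_shiftRuns {N : ℕ} (c : Bool) (z z' : ℤ) (W : List (Bool × ℤ))
    (h : (W ++ [(c, z)]).IsChain (RunRel N)) :
    (shiftRuns c W ++ [(c, z')]).IsChain (RunRel (N + 1)) := by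
  induction W with
  | nil => simp [shiftRuns]
  | cons p W ih =>
    rcases p with ⟨ε, k⟩
    rcases W with _ | ⟨q, W⟩
    · simp only [shiftRuns, List.cons_append, List.nil_append, List.isChain_cons_cons,
        List.IsChain.singleton, and_true] at h ⊢
      revert h
      cases ε <;> cases c <;> (simp [RunRel, negCount, headSign]; try omega)
    · have ih := ih (List.isChain_cons_cons.1 h).2
      simp only [shiftRuns, List.cons_append, List.isChain_cons_cons] at h ih ⊢
      refine ⟨?_, ih⟩
      have h := h.1
      rcases q with ⟨δ, l⟩
      revert h
      cases ε <;> cases δ <;> (simp [RunRel, negCount, headSign]; try omega)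

/-- Opens the cycle: as the relation sees only the sign of its second argument, a final run with the
first sign and any exponent can stand for the return to the start. -/
theorem chain_coe_iff {R : Bool × ℤ → Bool × ℤ → Prop} (hR : ∀ p ε k l, R p (ε, k) → R p (ε, l))
    {W : List (Bool × ℤ)} (hW : W ≠ []) :
    Cycle.Chain R (W : Cycle (Bool × ℤ)) ↔ ∀ z, (W ++ [(headSign true W, z)]).IsChain R := by
  rcases W with _ | ⟨p, W⟩
  · exact absurd rfl hW
  · rw [Cycle.chain_coe_cons]
    constructor
    · intro h z
      rw [← List.cons_append, List.isChain_append] at h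
      rw [List.isChain_append]
      refine ⟨h.1, by simp, ?_⟩
      intro x hx y hy
      simp only [List.head?_cons, Option.mem_def, Option.some.injEq] at hy
      subst hy
      have := h.2.2 x hx p (by simp)
      exact hR x p.1 p.2 z this
    · intro h
      exact h p.2

theorem RunRel.change {N : ℕ} (p : Bool × ℤ) (ε : Bool) (k l : ℤ) (h : RunRel N p (ε, k)) :
    RunRel N p (ε, l) := h

theorem RunClass.autL_symm {N : ℕ} {g : F2} (h : RunClass N g) :
    RunClass (N + 1) (MulEquiv.symm autL g) := by
  obtain ⟨W, hW, hc, hg⟩ := h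
  have hW' : shiftRuns (headSign true W) W ≠ [] := by
    cases W
    · exact absurd rfl hW
    · simp [shiftRuns]
  refine ⟨shiftRuns (headSign true W) W, hW', ?_, ?_⟩
  · rw [chain_coe_iff RunRel.change hW']
    rw [chain_coe_iff RunRel.change hW] at hc
    intro z
    have : headSign true (shiftRuns (headSign true W) W) = headSign true W := by
      cases W <;> rfl
    rw [this]
    exact isChain_shiftRuns _ _ _ _ (hc z)
  · refine (isConj_map_aut autL⁻¹ hg).trans ?_
    rw [MulAut.inv_apply, autL_symm_prodRuns (headSign true W)]
    have : headSign (headSign true W) W = headSign true W := by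
      cases W <;> rfl
    rw [this, isConj_comm, isConj_iff]
    exact ⟨_, by rw [← zpow_neg]⟩

theorem NoNegB.autL_symm {g : F2} (h : NoNegB g) : NoNegB (MulEquiv.symm autL g) := by
  rcases h with ⟨k, hk⟩ | ⟨W, hW, hk⟩
  · refine Or.inl ⟨k, (isConj_map_aut autL⁻¹ hk).trans ?_⟩
    rw [MulAut.inv_apply, map_zpow, autL_symm_zero]
  · refine Or.inr ⟨shiftRuns true W, ?_, (isConj_map_aut autL⁻¹ hk).trans ?_⟩
    · clear hk
      induction W with
      | nil => simp [shiftRuns]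
      | cons p W ih =>
        simp only [shiftRuns, List.mem_cons, forall_eq_or_imp] at hW ⊢
        exact ⟨hW.1, ih hW.2⟩
    · rw [MulAut.inv_apply, autL_symm_prodRuns true]
      have : headSign true W = true := by
        rcases W with _ | ⟨p, W⟩
        · rfl
        · exact hW p (by simp)
      have h0 : negCount true = 0 := rfl
      rw [this, h0, neg_zero, zpow_zero, one_mul, mul_one]

/-! #### Passing between runs and letters -/

/-- The letters of a run. -/
def runLetters (p : Bool × ℤ) : List (Fin 2 × Bool) :=
  (1, p.1) :: List.replicate p.2.natAbs (0, decide (0 ≤ p.2))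

theorem mk_replicate (s : Bool) (n : ℕ) :
    FreeGroup.mk (List.replicate n ((0 : Fin 2), s)) = FreeGroup.mk [(0, s)] ^ n := by
  induction n with
  | zero => simp [FreeGroup.one_eq_mk]
  | succ n ih => rw [List.replicate_succ, pow_succ', ← ih, FreeGroup.mul_mk, List.singleton_append]

theorem mk_replicate_natAbs (k : ℤ) :
    FreeGroup.mk (List.replicate k.natAbs ((0 : Fin 2), decide (0 ≤ k))) = FreeGroup.of 0 ^ k := by
  rw [mk_replicate]
  rcases Int.le_total 0 k with h | h
  · obtain ⟨n, rfl⟩ := Int.eq_ofNat_of_zero_le h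
    simp [FreeGroup.of]
  · obtain ⟨n, rfl⟩ := Int.exists_eq_neg_ofNat h
    rcases n with _ | n
    · simp
    · have : decide (0 ≤ -(((n + 1 : ℕ) : ℤ))) = false := by
        simp only [decide_eq_false_iff_not]; omega
      rw [this]
      have h2 : FreeGroup.mk [((0 : Fin 2), false)] = (FreeGroup.of 0)⁻¹ := rfl
      rw [h2, zpow_neg, zpow_natCast, Int.natAbs_neg, Int.natAbs_natCast, inv_pow]

theorem mk_flatMap_runLetters (W : List (Bool × ℤ)) :
    FreeGroup.mk (W.flatMap runLetters) = prodRuns W := by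
  induction W with
  | nil => rfl
  | cons p W ih =>
    rw [List.flatMap_cons, ← FreeGroup.mul_mk, ih, prodRuns_cons, runLetters,
      ← List.singleton_append, ← FreeGroup.mul_mk, mk_replicate_natAbs]

/-- Replacing the nodes of a cyclic path by blocks. -/
theorem chain_flatMap {α β : Type*} {R : α → α → Prop} {r : β → β → Prop} {f : α → List β}
    (h : ∀ p q, R p q → (f p).IsChain r ∧ f p ≠ [] ∧
      ∀ x ∈ (f p).getLast?, ∀ y ∈ (f q).head?, r x y)
    {W : List α} (hW : Cycle.Chain R (W : Cycle α)) :
    Cycle.Chain r (W.flatMap f : Cycle β) := by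
  have key : ∀ (L : List α) (p q : α) (y : β), y ∈ (f q).head? → (p :: (L ++ [q])).IsChain R →
      ((p :: L).flatMap f ++ [y]).IsChain r := by
    intro L
    induction L with
    | nil =>
      intro p q y hy hc
      obtain ⟨h1, h2, h3⟩ := h p q (by simpa using hc)
      rw [List.flatMap_singleton, List.isChain_append]
      refine ⟨h1, by simp, ?_⟩
      intro x hx z hz
      simp only [List.head?_cons, Option.mem_def, Option.some.injEq] at hz
      subst hz
      exact h3 x hx y hy
    | cons p' L ih =>
      intro p q y hy hc
      rw [List.cons_append, List.isChain_cons_cons] at hc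
      obtain ⟨h1, h2, h3⟩ := h p p' hc.1
      have ih' := ih p' q y hy hc.2
      rw [List.flatMap_cons, List.append_assoc, List.isChain_append]
      refine ⟨h1, ih', ?_⟩
      intro x hx z hz
      refine h3 x hx z ?_
      have h4 : f p' ≠ [] := by
        rcases hl : L ++ [q] with _ | ⟨q', L'⟩
        · simp at hl
        · rw [hl, List.isChain_cons_cons] at hc
          exact (h p' q' hc.2.1).2.1
      rw [List.flatMap_cons, List.append_assoc] at hz
      rcases hf : f p' with _ | ⟨t, T⟩
      · exact absurd hf h4
      · rw [hf] at hz
        simpa using hz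
  rcases W with _ | ⟨p, W⟩
  · simp
  · rw [Cycle.chain_coe_cons] at hW
    have hp : f p ≠ [] := by
      rcases hl : W ++ [p] with _ | ⟨q', L'⟩
      · simp at hl
      · rw [hl, List.isChain_cons_cons] at hW
        exact (h p q' hW.1).2.1
    rcases hf : f p with _ | ⟨t, T⟩
    · exact absurd hf hp
    · have := key W p p t (by simp [hf]) hW
      rw [List.flatMap_cons, hf, List.cons_append, Cycle.chain_coe_cons]
      simpa [hf] using this

/-- The relation on consecutive letters of a reduced word in which each `b⁻¹` stands between two
letters `a`. -/
def IsolatedB (p q : Fin 2 × Bool) : Prop :=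
  NotCancel p q ∧ (p = (1, false) → q = (0, true)) ∧ (q = (1, false) → p = (0, true))

/-- The relation on consecutive letters of a reduced word in which each `a⁻¹` stands between two
letters `b`. -/
def IsolatedA (p q : Fin 2 × Bool) : Prop :=
  NotCancel p q ∧ (p = (0, false) → q = (1, true)) ∧ (q = (0, false) → p = (1, true))

theorem runLetters_isolatedB {p q : Bool × ℤ} (h : (p.1 = true ∧ q.1 = true) ∨ 1 ≤ p.2) :
    (runLetters p).IsChain IsolatedB ∧ runLetters p ≠ [] ∧
      ∀ x ∈ (runLetters p).getLast?, ∀ y ∈ (runLetters q).head?, IsolatedB x y := by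
  rcases p with ⟨ε, k⟩
  rcases q with ⟨δ, l⟩
  refine ⟨?_, by simp [runLetters], ?_⟩
  · simp only [runLetters]
    rcases hn : k.natAbs with _ | n
    · simp
    · rw [List.replicate_succ, List.isChain_cons_cons, ← List.replicate_succ]
      refine ⟨?_, List.isChain_replicate_of_rel _ ⟨fun _ => rfl, by simp, by simp⟩⟩
      refine ⟨by simp [NotCancel], ?_, by simp⟩
      rcases h with h | h
      · simp only at h
        simp [h.1]
      · simp only at h
        intro _
        have : 0 ≤ k := by omega
        simp [this]
  · intro x hx y hy
    simp only [runLetters, List.head?_cons, Option.mem_def, Option.some.injEq] at hy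
    subst hy
    simp only [runLetters] at hx
    rcases hn : k.natAbs with _ | n
    · have hk : k = 0 := by omega
      simp only at h
      rcases h with h | h
      · simp [hk] at hx
        subst hx
        simp [IsolatedB, NotCancel, h]
      · omega
    · rw [hn, List.replicate_succ', ← List.cons_append, List.getLast?_concat] at hx
      simp only [Option.mem_def, Option.some.injEq] at hx
      subst hx
      refine ⟨by simp [NotCancel], by simp, ?_⟩
      intro hδ
      simp only at h
      rcases h with h | h
      · simp [h.2] at hδ
      · have : 0 ≤ k := by omega
        simp [this]

/-- This fails for parameter 0, which admits `b⁻¹a⁰b⁻¹`; hence the `N + 1` in `MixedClass`. -/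
theorem RunRel.pos_or {N : ℕ} {p q : Bool × ℤ} (h : RunRel (N + 1) p q) :
    (p.1 = true ∧ q.1 = true) ∨ 1 ≤ p.2 := by
  rcases p with ⟨ε, k⟩
  rcases q with ⟨δ, l⟩
  revert h
  cases ε <;> cases δ <;> (simp [RunRel]; try omega)

/-- The exchange of the generators on letters. -/
def swapLetter (p : Fin 2 × Bool) : Fin 2 × Bool := (Equiv.swap 0 1 p.1, p.2)

theorem autSwap_mk (L : List (Fin 2 × Bool)) :
    autSwap (FreeGroup.mk L) = FreeGroup.mk (L.map swapLetter) := by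
  induction L with
  | nil => simp [← FreeGroup.one_eq_mk]
  | cons p L ih =>
    rw [← List.singleton_append, ← FreeGroup.mul_mk, map_mul, ih, List.map_append,
      ← FreeGroup.mul_mk]
    congr 1
    have of_true : ∀ i : Fin 2, FreeGroup.mk [(i, true)] = FreeGroup.of i := fun _ => rfl
    have of_false : ∀ i : Fin 2, FreeGroup.mk [(i, false)] = (FreeGroup.of i)⁻¹ := fun _ => rfl
    rcases p with ⟨i, s⟩
    fin_cases i <;> cases s <;> simp [swapLetter, of_true, of_false]

theorem isolatedA_swapLetter {p q : Fin 2 × Bool} (h : IsolatedB p q) :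
    IsolatedA (swapLetter p) (swapLetter q) := by
  revert h
  rcases p with ⟨i, s⟩
  rcases q with ⟨j, t⟩
  fin_cases i <;> fin_cases j <;> cases s <;> cases t <;>
    simp [IsolatedA, IsolatedB, NotCancel, swapLetter]

/-- Cutting a word with isolated letters `a⁻¹` into runs. The word is preceded by the letter `x` and
followed by `b^c`. -/
theorem exists_runs (c : Bool) (l : List (Fin 2 × Bool)) (x : Fin 2 × Bool)
    (h : (x :: (l ++ [(1, c)])).IsChain IsolatedA) :
    ∃ (k : ℤ) (W : List (Bool × ℤ)), FreeGroup.mk l = FreeGroup.of 0 ^ k * prodRuns W ∧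
      (∀ ε, x = (1, ε) → ∀ z, ((ε, k) :: (W ++ [(c, z)])).IsChain (RunRel 0)) ∧
      (x = (0, true) → 0 ≤ k ∧ ∀ z, (W ++ [(c, z)]).IsChain (RunRel 0)) ∧
      (x = (0, false) → k = 0 ∧ ∀ z, ((true, -1) :: (W ++ [(c, z)])).IsChain (RunRel 0)) := by
  -- The clauses record the unfinished run. After `b^ε` the exponent `k` completes it; after `a` one
  -- has `k ≥ 0`, so that the added `a` makes it positive; after `a⁻¹` the next letter must be `b`,
  -- so the run is exactly `ba⁻¹`.
  induction l generalizing x with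
  | nil =>
    refine ⟨0, [], by simp [FreeGroup.one_eq_mk], ?_, ?_, ?_⟩
    · rintro ε rfl z
      have hr : IsolatedA (1, ε) (1, c) := by simpa using h
      have : ε = c := hr.1 rfl
      subst this
      cases ε <;> simp [RunRel]
    · rintro rfl
      simp
    · rintro rfl
      have hr : IsolatedA (0, false) (1, c) := by simpa using h
      have : c = true := by simpa using hr.2.1 rfl
      subst this
      simp [RunRel]
  | cons y l ih =>
    rw [List.cons_append, List.isChain_cons_cons] at h
    obtain ⟨k, W, hm, h1, h2, h3⟩ := ih y h.2
    have hr := h.1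
    have hmk : FreeGroup.mk (y :: l) = FreeGroup.mk [y] * (FreeGroup.of 0 ^ k * prodRuns W) := by
      rw [← hm, FreeGroup.mul_mk, List.singleton_append]
    rcases y with ⟨i, s⟩
    obtain rfl | rfl : i = 0 ∨ i = 1 := by omega
    · cases s
      · obtain ⟨hk, h4⟩ := h3 rfl
        subst hk
        have hx : x = (1, true) := hr.2.2 rfl
        subst hx
        refine ⟨-1, W, ?_, ?_, by simp, by simp⟩
        · rw [hmk]
          simp [FreeGroup.of, FreeGroup.inv_mk, FreeGroup.invRev]
        · intro ε hε z
          have : ε = true := by simpa using hε.symm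
          subst this
          exact h4 z
      · obtain ⟨hk, h2⟩ := h2 rfl
        refine ⟨k + 1, W, ?_, ?_, ?_, ?_⟩
        · rw [hmk, add_comm, zpow_one_add, mul_assoc]
          rfl
        · rintro ε rfl z
          have := h2 z
          rcases hW : W ++ [(c, z)] with _ | ⟨q, W'⟩
          · simp at hW
          · rw [hW] at this
            rw [List.isChain_cons_cons]
            refine ⟨?_, this⟩
            rcases q with ⟨δ, l⟩
            cases ε <;> cases δ <;> (simp [RunRel]; try omega)
        · rintro rfl
          exact ⟨by omega, h2⟩
        · rintro rfl
          simpa using hr.2.1 rfl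
    · have h1 := h1 s rfl
      refine ⟨0, (s, k) :: W, ?_, ?_, ?_, ?_⟩
      · rw [hmk]
        simp [mul_assoc]
      · rintro ε rfl z
        have : ε = s := hr.1 rfl
        subst this
        rw [List.cons_append, List.isChain_cons_cons]
        refine ⟨?_, h1 z⟩
        cases ε <;> simp [RunRel]
      · rintro rfl
        exact ⟨le_rfl, h1⟩
      · rintro rfl
        have : s = true := by simpa using hr.2.1 rfl
        subst this
        refine ⟨rfl, fun z => ?_⟩
        rw [List.cons_append, List.isChain_cons_cons]
        exact ⟨by simp [RunRel], h1 z⟩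

/-- If some letter `b^{±1}` occurs, the word is rotated to begin there and cut into runs. Otherwise
`a⁻¹` cannot occur either, since its neighbours would be `b`, and the word is a power of `a`. -/
theorem runClass_of_isolatedA {w : List (Fin 2 × Bool)}
    (h : Cycle.Chain IsolatedA (w : Cycle (Fin 2 × Bool))) :
    NoNegB (FreeGroup.mk w) ∨ RunClass 0 (FreeGroup.mk w) := by
  by_cases hb : ∃ c, (1, c) ∈ w
  · right
    obtain ⟨c, hc⟩ := hb
    obtain ⟨l₁, l₂, rfl⟩ := List.append_of_mem hc
    have hrot : (l₁ ++ (1, c) :: l₂) ~r ((1, c) :: l₂ ++ l₁) := List.isRotated_append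
    rw [Cycle.coe_eq_coe.2 hrot, List.cons_append, Cycle.chain_coe_cons] at h
    obtain ⟨k, W, hm, h1, -, -⟩ := exists_runs c (l₂ ++ l₁) (1, c) h
    refine ⟨(c, k) :: W, by simp, ?_, ?_⟩
    · rw [Cycle.chain_coe_cons]
      exact h1 c rfl k
    · refine (isConj_of_isRotated hrot).trans ?_
      rw [prodRuns_cons, mul_assoc, ← hm, FreeGroup.mul_mk, List.singleton_append,
        List.cons_append]
  · left
    left
    have hall : ∀ p ∈ w, p = (0, true) := by
      push Not at hb
      have h0 : ∀ p ∈ w, p.1 = 0 := by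
        rintro ⟨i, s⟩ hp
        obtain rfl | rfl : i = 0 ∨ i = 1 := by omega
        · rfl
        · exact absurd hp (hb s)
      rintro ⟨i, s⟩ hp
      have hi : i = 0 := h0 _ hp
      subst hi
      cases s
      · exfalso
        obtain ⟨l₁, l₂, rfl⟩ := List.append_of_mem hp
        have hrot : (l₁ ++ (0, false) :: l₂) ~r ((0, false) :: l₂ ++ l₁) := List.isRotated_append
        rw [Cycle.coe_eq_coe.2 hrot, List.cons_append, Cycle.chain_coe_cons] at h
        rcases hl : (l₂ ++ l₁) ++ [((0 : Fin 2), false)] with _ | ⟨q, L⟩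
        · simp at hl
        · rw [hl, List.isChain_cons_cons] at h
          have hq := h.1.2.1 rfl
          have : q ∈ (l₂ ++ l₁) ++ [((0 : Fin 2), false)] := by simp [hl]
          have := h0 q (by simp at this ⊢; tauto)
          simp [hq] at this
      · rfl
    refine ⟨w.length, ?_⟩
    rw [zpow_natCast]
    generalize hn : w.length = n
    rw [List.eq_replicate_iff.2 ⟨hn, hall⟩, mk_replicate]
    exact IsConj.refl _

/-- In such a cyclic word each `b⁻¹` stands between two letters `a`. Exchanging the generators gives
isolated letters `a⁻¹`, which is the condition with parameter 0. -/
theorem RunClass.of_swap {N : ℕ} {g : F2} (h : RunClass (N + 1) (autSwap g)) :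
    NoNegB g ∨ RunClass 0 g := by
  obtain ⟨W, hW, hc, hg⟩ := h
  have h1 : Cycle.Chain IsolatedB (W.flatMap runLetters : Cycle (Fin 2 × Bool)) :=
    chain_flatMap (fun p q hpq => runLetters_isolatedB hpq.pos_or) hc
  have h2 : Cycle.Chain IsolatedA ((W.flatMap runLetters).map swapLetter :
      Cycle (Fin 2 × Bool)) := by
    rw [← Cycle.map_coe, Cycle.chain_map]
    exact h1.imp fun p q => isolatedA_swapLetter
  have h3 := isConj_map_aut autSwap hg
  rw [autSwap_autSwap, ← mk_flatMap_runLetters, autSwap_mk] at h3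
  exact (runClass_of_isolatedA h2).imp (fun h => h.of_isConj h3) (fun h => h.of_isConj h3)

theorem NoNegB.of_swap {g : F2} (h : NoNegB (autSwap g)) : NoNegB g ∨ RunClass 0 g := by
  rcases h with ⟨k, hk⟩ | ⟨W, hW, hk⟩
  · have h3 := isConj_map_aut autSwap hk
    rw [autSwap_autSwap, ← mk_replicate_natAbs, autSwap_mk, List.map_replicate] at h3
    refine (runClass_of_isolatedA ?_).imp (fun h => h.of_isConj h3) (fun h => h.of_isConj h3)
    refine Cycle.chain_of_pairwise ?_
    intro p hp q hq
    simp only [Cycle.mem_coe_iff] at hp hq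
    rw [List.eq_of_mem_replicate hp, List.eq_of_mem_replicate hq]
    exact ⟨fun _ => rfl, by simp [swapLetter], by simp [swapLetter]⟩
  · have h0 : Cycle.Chain (fun p q : Bool × ℤ => p.1 = true ∧ q.1 = true)
        (W : Cycle (Bool × ℤ)) := Cycle.chain_of_pairwise fun p hp q hq => ⟨hW p hp, hW q hq⟩
    have h1 : Cycle.Chain IsolatedB (W.flatMap runLetters : Cycle (Fin 2 × Bool)) :=
      chain_flatMap (fun p q hpq => runLetters_isolatedB (Or.inl hpq)) h0
    have h2 : Cycle.Chain IsolatedA ((W.flatMap runLetters).map swapLetter :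
        Cycle (Fin 2 × Bool)) := by
      rw [← Cycle.map_coe, Cycle.chain_map]
      exact h1.imp fun p q => isolatedA_swapLetter
    have h3 := isConj_map_aut autSwap hk
    rw [autSwap_autSwap, ← mk_flatMap_runLetters, autSwap_mk] at h3
    exact (runClass_of_isolatedA h2).imp (fun h => h.of_isConj h3) (fun h => h.of_isConj h3)

/-- Elements described through `autSwap` are first rewritten directly, which resets the parameter to
0; `autL⁻¹` raises it to 1, back inside the class. -/
theorem MixedClass.autL_symm {g : F2} (h : MixedClass g) : MixedClass (MulEquiv.symm autL g) := by
  have key : NoNegB g ∨ RunClass 0 g → MixedClass (MulEquiv.symm autL g) := by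
    rintro (h | h)
    · exact Or.inl h.autL_symm
    · exact Or.inr (Or.inr (Or.inl ⟨0, h.autL_symm⟩))
  rcases h with h | h | ⟨N, h⟩ | ⟨N, h⟩
  · exact Or.inl h.autL_symm
  · exact key h.of_swap
  · exact Or.inr (Or.inr (Or.inl ⟨N + 1, h.autL_symm⟩))
  · exact key h.of_swap

theorem MixedClass.autU_symm {g : F2} (h : MixedClass g) : MixedClass (MulEquiv.symm autU g) := by
  have e : autU⁻¹ = autSwap * autL⁻¹ * autSwap := mulAut_ext (by simp) (by simp)
  have := h.swap.autL_symm.swap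
  have e2 : MulEquiv.symm autU g = autSwap (MulEquiv.symm autL (autSwap g)) := by
    rw [← MulAut.inv_apply, e]; rfl
  rwa [e2]

/-! #### Potentially positive elements -/

theorem exists_posRuns {g : F2} (h : Positive g) : ∃ (k : ℤ) (W : List (Bool × ℤ)),
    (∀ p ∈ W, p.1 = true) ∧ g = FreeGroup.of 0 ^ k * prodRuns W := by
  induction h using Submonoid.closure_induction_left with
  | one => exact ⟨0, [], by simp, by simp⟩
  | mul_left x hx y hy ih =>
    obtain ⟨k, W, hW, rfl⟩ := ih
    obtain ⟨i, rfl⟩ := hx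
    obtain rfl | rfl : i = 0 ∨ i = 1 := by omega
    · exact ⟨k + 1, W, hW, by rw [add_comm, zpow_one_add, mul_assoc]⟩
    · refine ⟨0, (true, k) :: W, ?_, ?_⟩
      · simp only [List.mem_cons, forall_eq_or_imp, true_and]
        exact hW
      · rw [prodRuns_cons, zpow_zero, one_mul, mul_assoc]
        rfl

theorem Positive.noNegB {g : F2} (h : Positive g) : NoNegB g := by
  obtain ⟨k, W, hW, rfl⟩ := exists_posRuns h
  rcases List.eq_nil_or_concat' W with rfl | ⟨W, ⟨ε, l⟩, rfl⟩
  · exact Or.inl ⟨k, by rw [prodRuns_nil, mul_one]⟩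
  · refine Or.inr ⟨W ++ [(ε, l + k)], ?_, ?_⟩
    · intro p hp
      simp only [List.mem_append, List.mem_singleton] at hp hW
      rcases hp with hp | rfl
      · exact hW p (Or.inl hp)
      · exact hW (ε, l) (Or.inr rfl)
    · rw [isConj_iff]
      refine ⟨FreeGroup.of 0 ^ (-k), ?_⟩
      rw [prodRuns_append, prodRuns_append]
      simp only [prodRuns_cons, prodRuns_nil, mul_one, zpow_add]
      group

theorem positive_map {φ : MulAut F2} (h : ∀ i, Positive (φ (FreeGroup.of i))) {g : F2}
    (hg : Positive g) : Positive (φ g) := by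
  induction hg using Submonoid.closure_induction_left with
  | one => rw [map_one]; exact one_mem _
  | mul_left x hx y hy ih =>
    obtain ⟨i, rfl⟩ := hx
    rw [map_mul]
    exact mul_mem (h i) ih

theorem mixedClass_of_positive {u : F2} (hu : Positive u) {π : MulAut F2}
    (hπ : π ∈ Submonoid.closure {autU, autL} ∨ π ∈ Submonoid.closure {autU⁻¹, autL⁻¹}) :
    MixedClass (π u) := by
  have pos_of : ∀ i : Fin 2, Positive (FreeGroup.of i) := fun i => Submonoid.subset_closure ⟨i, rfl⟩
  rcases hπ with hπ | hπ
  · left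
    refine Positive.noNegB ?_
    induction hπ using Submonoid.closure_induction_left with
    | one => exact hu
    | mul_left x hx y hy ih =>
      rw [MulAut.mul_apply]
      refine positive_map ?_ ih
      simp only [Set.mem_insert_iff, Set.mem_singleton_iff] at hx
      intro i
      obtain rfl | rfl : i = 0 ∨ i = 1 := by omega
      · rcases hx with rfl | rfl
        · rw [autU_zero]; exact mul_mem (pos_of 0) (pos_of 1)
        · rw [autL_zero]; exact pos_of 0
      · rcases hx with rfl | rfl
        · rw [autU_one]; exact pos_of 1
        · rw [autL_one]; exact mul_mem (pos_of 1) (pos_of 0)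
  · induction hπ using Submonoid.closure_induction_left with
    | one => exact Or.inl hu.noNegB
    | mul_left x hx y hy ih =>
      simp only [Set.mem_insert_iff, Set.mem_singleton_iff] at hx
      rw [MulAut.mul_apply]
      rcases hx with rfl | rfl
      · exact ih.autU_symm
      · exact ih.autL_symm

theorem PotentiallyPositive.exists_signedPerm {g : F2} (hg : PotentiallyPositive g) :
    ∃ σ ∈ signedPerms, NoNegB (σ g) ∨ ∃ N, RunClass (N + 1) (σ g) := by
  obtain ⟨φ, hφ⟩ := hg
  obtain ⟨σ, hσ, π, h, hπ⟩ := exists_conj_normalForm φ⁻¹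
  have h1 := h (φ g)
  rw [MulAut.inv_apply, MulEquiv.symm_apply_apply] at h1
  have h2 := isConj_map_aut σ⁻¹ h1
  rw [MulAut.inv_apply_self] at h2
  have h3 := (mixedClass_of_positive hφ hπ).of_isConj h2
  have hswap : ∀ x, (autSwap * σ⁻¹) x = autSwap (σ⁻¹ x) := fun _ => rfl
  rcases h3 with h | h | h | h
  · exact ⟨σ⁻¹, inv_mem hσ, Or.inl h⟩
  · exact ⟨autSwap * σ⁻¹, mul_mem autSwap_mem (inv_mem hσ), Or.inl h⟩
  · exact ⟨σ⁻¹, inv_mem hσ, Or.inr h⟩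
  · exact ⟨autSwap * σ⁻¹, mul_mem autSwap_mem (inv_mem hσ), Or.inr h⟩

end Runs

/-! ### The language of the automaton -/

section Language

/-- A cycle is a chain if and only if the relation holds for all pairs of consecutive elements. -/
theorem cycle_chain_iff {α : Type*} {r : α → α → Prop} {W : List α} :
    Cycle.Chain r (W : Cycle α) ↔ ∀ p L, W ~r (p :: L) → ∀ q ∈ (L ++ [p]).head?, r p q := by
  constructor
  · intro h p L hW q hq
    rw [Cycle.coe_eq_coe.2 hW, Cycle.chain_coe_cons] at h
    rcases hl : L ++ [p] with _ | ⟨q', L'⟩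
    · simp at hl
    · rw [hl] at hq h
      simp only [List.head?_cons, Option.mem_def, Option.some.injEq] at hq
      subst hq
      exact (List.isChain_cons_cons.1 h).1
  · intro h
    rcases W with _ | ⟨a, m⟩
    · simp
    · rw [Cycle.chain_coe_cons, List.isChain_iff_forall_rel_of_append_cons_cons]
      intro x y l₁ l₂ e
      rcases List.eq_nil_or_concat' l₂ with rfl | ⟨l₂, z, rfl⟩
      · have e1 : (a :: m) ++ [a] = (l₁ ++ [x]) ++ [y] := by simpa using e
        obtain ⟨e2, e3⟩ := List.append_inj' e1 rfl
        simp only [List.cons.injEq, and_true] at e3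
        subst e3
        refine h x l₁ ?_ a ?_
        · rw [e2]
          simpa using (List.isRotated_append (l := l₁) (l' := [x]))
        · rw [← e2]
          simp
      · have e1 : (a :: m) ++ [a] = (l₁ ++ x :: y :: l₂) ++ [z] := by simpa using e
        obtain ⟨e2, e3⟩ := List.append_inj' e1 rfl
        refine h x (y :: l₂ ++ l₁) ?_ y (by simp)
        rw [e2]
        exact List.isRotated_append

theorem exists_succ {α : Type*} {r : α → α → Prop} {W : List α}
    (h : Cycle.Chain r (W : Cycle α)) {p : α} (hp : p ∈ W) : ∃ q, r p q := by
  obtain ⟨l₁, l₂, rfl⟩ := List.append_of_mem hp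
  rcases hl : (l₂ ++ l₁) ++ [p] with _ | ⟨q', L'⟩
  · simp at hl
  · exact ⟨q', cycle_chain_iff.1 h p (l₂ ++ l₁) List.isRotated_append q' (by simp [hl])⟩

theorem isClosedPath_iff {V : Type*} {G : Digraph V} {p : List V} :
    IsClosedPath G p ↔ Cycle.Chain G.Adj (p : Cycle V) := by
  rcases p with _ | ⟨x, p⟩
  · simp [IsClosedPath]
  · rw [Cycle.chain_coe_cons, ← List.cons_append, List.isChain_append, IsClosedPath]
    simp only [List.IsChain.singleton, true_and, List.head?_cons, Option.mem_some_iff,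
      forall_eq']

/-- The nodes of the lower-bound automaton joined by an edge. -/
abbrev Edge (i j : Fin 5) : Prop := lowerBoundAutomaton.graph.Adj i j

/-- The labels of the lower-bound automaton. -/
abbrev nodeLabel : Fin 5 → Fin 2 × Bool := lowerBoundAutomaton.label

instance : DecidableRel Edge := fun i j =>
  inferInstanceAs (Decidable ((i, j) ∈
    ([(0, 0), (0, 1), (0, 3), (1, 2), (2, 2), (2, 3), (3, 3), (3, 0), (3, 4), (4, 4), (4, 3)] :
      List (Fin 5 × Fin 5))))

theorem mem_rinf_iff {w : List (Fin 2 × Bool)} : w ∈ Rinf ↔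
    ∃ p : List (Fin 5), Cycle.Chain Edge (p : Cycle (Fin 5)) ∧ p.map nodeLabel = w := by
  simp only [Rinf, Automaton.language, Set.mem_ofPred_eq, isClosedPath_iff]

theorem rinf_of_isRotated {w w' : List (Fin 2 × Bool)} (h : w ~r w') (hw : w ∈ Rinf) :
    w' ∈ Rinf := by
  rw [mem_rinf_iff] at *
  obtain ⟨p, hp, rfl⟩ := hw
  obtain ⟨n, rfl⟩ := h
  refine ⟨p.rotate n, ?_, (List.map_rotate _ _ _)⟩
  have : (p.rotate n : Cycle (Fin 5)) = p := Cycle.coe_eq_coe.2 (List.IsRotated.symm ⟨n, rfl⟩)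
  rwa [this]

theorem edge_notCancel : ∀ i j : Fin 5, Edge i j → NotCancel (nodeLabel i) (nodeLabel j) := by
  have : ∀ i j : Fin 5, Edge i j →
      (nodeLabel i).1 = (nodeLabel j).1 → (nodeLabel i).2 = (nodeLabel j).2 := by
    decide
  exact this

theorem isCyclicallyReduced_of_mem_rinf {w : List (Fin 2 × Bool)} (h : w ∈ Rinf) :
    FreeGroup.IsCyclicallyReduced w := by
  obtain ⟨p, hp, rfl⟩ := mem_rinf_iff.1 h
  rw [isCyclicallyReduced_iff_chain, ← Cycle.map_coe, Cycle.chain_map]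
  exact hp.imp edge_notCancel

/-! #### Words of the language are potentially positive -/

theorem PotentiallyPositive.of_isConj {g h : F2} (hg : PotentiallyPositive g) (hc : IsConj g h) :
    PotentiallyPositive h := by
  obtain ⟨φ, hφ⟩ := hg
  obtain ⟨c, rfl⟩ := isConj_iff.1 hc
  refine ⟨(φ * MulAut.conj c⁻¹ : MulAut F2), ?_⟩
  have : (φ * MulAut.conj c⁻¹ : MulAut F2) (c * g * c⁻¹) = φ g := by
    rw [MulAut.mul_apply]
    congr 1
    simp [mul_assoc]
  rwa [this]

theorem potentiallyPositive_replicate (p : Fin 2 × Bool) (n : ℕ) :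
    PotentiallyPositive (FreeGroup.mk (List.replicate n p)) := by
  obtain ⟨q, hq⟩ : ∃ q : Fin 2 × Bool, p.1 ≠ q.1 :=
    ⟨(p.1 + 1, true), by rcases p with ⟨i, s⟩; fin_cases i <;> simp⟩
  obtain ⟨σ, -, h0, -⟩ := exists_signedPerm hq
  refine ⟨(σ⁻¹ : MulAut F2), ?_⟩
  have : FreeGroup.mk (List.replicate n p) = FreeGroup.mk [p] ^ n := by
    rw [FreeGroup.pow_mk]
    simp
  rw [this, map_pow, ← h0, MulAut.inv_apply_self]
  have h : Positive (FreeGroup.of (0 : Fin 2)) := Submonoid.subset_closure ⟨0, rfl⟩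
  exact pow_mem h n

/-- The automorphism `a ↦ ab`, `b ↦ b(ab)^N`. -/
def autPos (N : ℕ) : MulAut F2 := autU * autL ^ N

theorem autPos_zero (N : ℕ) :
    autPos N (FreeGroup.of 0) = FreeGroup.of 0 * FreeGroup.of 1 := by
  have : (autL ^ N) (FreeGroup.of 0) = FreeGroup.of 0 := by
    induction N with
    | zero => simp
    | succ N ih => rw [pow_succ, MulAut.mul_apply, autL_zero, ih]
  rw [autPos, MulAut.mul_apply, this, autU_zero]

theorem autPos_one (N : ℕ) : autPos N (FreeGroup.of 1) =
    FreeGroup.of 1 * (FreeGroup.of 0 * FreeGroup.of 1) ^ N := by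
  have : (autL ^ N) (FreeGroup.of 1) = FreeGroup.of 1 * FreeGroup.of 0 ^ N := by
    induction N with
    | zero => simp
    | succ N ih =>
      rw [pow_succ', MulAut.mul_apply, ih, map_mul, map_pow, autL_zero, autL_one, pow_succ',
        mul_assoc]
  rw [autPos, MulAut.mul_apply, this, map_mul, map_pow, autU_zero, autU_one]

/-- The form of the image under `autPos N` of the word read along a path with `t` edges which
starts at the node labeled `b` and ends at the node `s`, multiplied by `(ab)^N`. -/
def PathInv (N t : ℕ) (s : Fin 5) (g : F2) : Prop :=
  ∃ P : F2, Positive P ∧ ∃ j : ℕ, g = P * (FreeGroup.of 0 * FreeGroup.of 1) ^ j ∧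
    (s = 0 → j = N + 1) ∧ (s = 3 → j = N) ∧ (s = 4 → N ≤ j + t)

theorem PathInv.step {N t : ℕ} {s s' : Fin 5} {g : F2} (h : PathInv N t s g) (hs : Edge s s')
    (ht : t < N) : PathInv N (t + 1) s' (g * autPos N (FreeGroup.mk [nodeLabel s'])) := by
  obtain ⟨P, hP, j, rfl, h0, h3, h4⟩ := h
  have pos_of : ∀ i : Fin 2, Positive (FreeGroup.of i) := fun i => Submonoid.subset_closure ⟨i, rfl⟩
  have pos_ab : Positive (FreeGroup.of (0 : Fin 2) * FreeGroup.of 1) :=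
    mul_mem (pos_of 0) (pos_of 1)
  have pos_pow : ∀ j, Positive ((FreeGroup.of (0 : Fin 2) * FreeGroup.of 1) ^ j) :=
    fun j => pow_mem pos_ab j
  have l0 : FreeGroup.mk [nodeLabel 0] = FreeGroup.of 0 := rfl
  have l1 : FreeGroup.mk [nodeLabel 1] = (FreeGroup.of 1)⁻¹ := rfl
  have l2 : FreeGroup.mk [nodeLabel 2] = FreeGroup.of 0 := rfl
  have l3 : FreeGroup.mk [nodeLabel 3] = FreeGroup.of 1 := rfl
  have l4 : FreeGroup.mk [nodeLabel 4] = (FreeGroup.of 0)⁻¹ := rfl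
  obtain rfl | rfl | rfl | rfl | rfl :
      s' = 0 ∨ s' = 1 ∨ s' = 2 ∨ s' = 3 ∨ s' = 4 := by omega
  · rw [l0, autPos_zero]
    have hj : j = N + 1 ∨ j = N := by
      have : s = 0 ∨ s = 3 := by clear h0 h3 h4; revert s; decide
      rcases this with h | h
      · exact Or.inl (h0 h)
      · exact Or.inr (h3 h)
    rcases hj with rfl | rfl
    · refine ⟨P * (FreeGroup.of 0 * FreeGroup.of 1), mul_mem hP pos_ab, N + 1, ?_, by simp,
        by simp, by simp⟩
      rw [mul_assoc, ← pow_succ, mul_assoc, ← pow_succ']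
    · exact ⟨P, hP, j + 1, by rw [mul_assoc, ← pow_succ], by simp, by simp, by simp⟩
  -- The node labeled `b⁻¹` is entered only from node 0, where `j = N + 1`, and `(ab)^(N+1)
  -- (ab)^(-N) b⁻¹ = a`.
  · have hs0 : s = 0 := by clear h0 h3 h4; revert s; decide
    rw [l1, map_inv, autPos_one, h0 hs0]
    refine ⟨P * FreeGroup.of 0, mul_mem hP (pos_of 0), 0, ?_, by simp, by simp, by simp⟩
    rw [pow_succ']
    group
  · rw [l2, autPos_zero]
    exact ⟨P * (FreeGroup.of 0 * FreeGroup.of 1) ^ (j + 1), mul_mem hP (pos_pow _), 0,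
      by rw [mul_assoc, ← pow_succ, pow_zero, mul_one], by simp, by simp, by simp⟩
  · rw [l3, autPos_one]
    exact ⟨P * (FreeGroup.of 0 * FreeGroup.of 1) ^ j * FreeGroup.of 1,
      mul_mem (mul_mem hP (pos_pow _)) (pos_of 1), N, by simp only [mul_assoc], by simp, by simp,
      by simp⟩
  -- Each `a⁻¹` removes one factor `ab`; with `t < N` at least one is still present.
  · have hj : N ≤ j + t := by
      have : s = 3 ∨ s = 4 := by clear h0 h3 h4; revert s; decide
      rcases this with h | h
      · have := h3 h; omega
      · exact h4 h
    rw [l4, map_inv, autPos_zero]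
    obtain ⟨i, rfl⟩ : ∃ i, j = i + 1 := ⟨j - 1, by omega⟩
    refine ⟨P, hP, i, ?_, by simp, by simp, fun _ => by omega⟩
    rw [pow_succ]
    group

theorem PathInv.path {N : ℕ} (L : List (Fin 5)) : ∀ {t : ℕ} {s : Fin 5} {g : F2},
    PathInv N t s g → (s :: L).IsChain Edge → t + L.length ≤ N →
    ∀ s' ∈ (s :: L).getLast?,
      PathInv N (t + L.length) s' (g * autPos N (FreeGroup.mk (L.map nodeLabel))) := by
  induction L with
  | nil =>
    intro t s g h _ _ s' hs'
    have : s = s' := by simpa using hs'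
    subst this
    simpa [← FreeGroup.one_eq_mk] using h
  | cons s' L ih =>
    intro t s g h hc ht s'' hs
    rw [List.isChain_cons_cons] at hc
    simp only [List.length_cons] at ht
    have := ih (h.step hc.1 (by omega)) hc.2 (by omega) s'' (by simpa using hs)
    rw [List.map_cons, ← List.singleton_append (l := L.map nodeLabel), ← FreeGroup.mul_mk,
      map_mul, ← mul_assoc, List.length_cons]
    convert this using 1
    omega

theorem rinf_subset_PP : Rinf ⊆ PP 2 := by
  intro w hw
  refine ⟨isCyclicallyReduced_of_mem_rinf hw, ?_⟩
  obtain ⟨p, hp, rfl⟩ := mem_rinf_iff.1 hw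
  by_cases h3 : (3 : Fin 5) ∈ p
  · obtain ⟨l₁, l₂, rfl⟩ := List.append_of_mem h3
    have hrot : (l₁ ++ 3 :: l₂) ~r (3 :: (l₂ ++ l₁)) := List.isRotated_append
    have hrot' : (3 :: (l₂ ++ l₁)) ~r ((l₂ ++ l₁) ++ [3]) := by
      simpa using (List.isRotated_append (l := [(3 : Fin 5)]) (l' := l₂ ++ l₁))
    rw [Cycle.coe_eq_coe.2 hrot, Cycle.chain_coe_cons] at hp
    refine PotentiallyPositive.of_isConj ?_
      (isConj_of_isRotated ((hrot.trans hrot').map nodeLabel)).symm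
    set L := l₂ ++ l₁ ++ [3] with hL
    -- Taking `N` to be the length of the path ensures that the stock suffices. Both ends are at
    -- node 3, where `j = N`, so conjugation by `(ab)^N` turns the image into `P`.
    have h := PathInv.path (N := L.length) L (t := 0) (s := 3)
      (g := (FreeGroup.of 0 * FreeGroup.of 1) ^ L.length)
      ⟨1, one_mem _, L.length, by simp, by simp, by simp, by simp⟩ hp (by simp) 3 (by
        rw [hL, ← List.cons_append, List.getLast?_concat]
        rfl)
    obtain ⟨P, hP, j, hj, -, hj3, -⟩ := h
    rw [hj3 rfl] at hj
    refine ⟨MulAut.conj ((FreeGroup.of 0 * FreeGroup.of 1) ^ L.length) * autPos L.length, ?_⟩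
    rw [MulAut.mul_apply, MulAut.conj_apply, hj, mul_inv_cancel_right]
    exact hP
  -- Away from node 3 every edge weakly increases the number of the node, so a closed path stays at
  -- one node.
  · have hle : Cycle.Chain (· ≤ ·) (p : Cycle (Fin 5)) := by
      rw [cycle_chain_iff] at hp ⊢
      intro x L hL q hq
      have e := hp x L hL q hq
      have hx : x ≠ 3 := by
        rintro rfl
        exact h3 (hL.mem_iff.2 (by simp))
      have hq3 : q ≠ 3 := by
        rintro rfl
        have := List.mem_of_mem_head? hq
        exact h3 (hL.mem_iff.2 (by simp at this ⊢; tauto))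
      clear hL hq
      revert x q
      decide
    rcases p with _ | ⟨s, p⟩
    · exact potentiallyPositive_replicate (0, true) 0
    · have : s :: p = List.replicate (s :: p).length s := by
        rw [List.eq_replicate_iff]
        refine ⟨rfl, fun b hb => ?_⟩
        exact Cycle.forall_eq_of_chain hle (by simpa using hb) (by simp)
      rw [this, List.map_replicate]
      exact potentiallyPositive_replicate _ _

/-! #### Sequences of runs that give words of the language -/

/-- The nodes of the automaton which spell a run. -/
def runPath (p : Bool × ℤ) : List (Fin 5) :=
  if p.1 then 3 :: List.replicate p.2.natAbs (if 0 ≤ p.2 then 0 else 4)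
  else 1 :: List.replicate p.2.natAbs 2

/-- The condition on consecutive runs for reading them along a path of the automaton. -/
def PathRel (p q : Bool × ℤ) : Prop :=
  (p.1 = true ∧ q.1 = true) ∨ (1 ≤ p.2 ∧ (p.1 = true ∨ q.1 = true))

theorem PathRel.runPath {p q : Bool × ℤ} (h : PathRel p q) :
    (runPath p).IsChain Edge ∧ runPath p ≠ [] ∧
      ∀ x ∈ (runPath p).getLast?, ∀ y ∈ (runPath q).head?, Edge x y := by
  have hhead : ∀ y ∈ (PotPos.runPath q).head?, y = if q.1 then 3 else 1 := by
    intro y hy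
    cases hq : q.1 <;> simp [PotPos.runPath, hq] at hy ⊢ <;> exact hy.symm
  have hrep : ∀ (x y : Fin 5) (n : ℕ), Edge x y → Edge y y →
      (x :: List.replicate n y).IsChain Edge := by
    intro x y n h1 h2
    rcases n with _ | n
    · simp
    · rw [List.replicate_succ, List.isChain_cons_cons, ← List.replicate_succ]
      exact ⟨h1, List.isChain_replicate_of_rel _ h2⟩
  have hlast : ∀ (x y z : Fin 5) (n : ℕ), z ∈ (x :: List.replicate n y).getLast? →
      (n = 0 ∧ z = x) ∨ (n ≠ 0 ∧ z = y) := by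
    intro x y z n hz
    rcases n with _ | n
    · simp at hz
      exact Or.inl ⟨rfl, hz.symm⟩
    · rw [List.replicate_succ', ← List.cons_append, List.getLast?_concat] at hz
      simp at hz
      exact Or.inr ⟨by simp, hz.symm⟩
  rcases p with ⟨ε, k⟩
  refine ⟨?_, by cases ε <;> simp [PotPos.runPath], ?_⟩
  · cases ε
    · simp only [PotPos.runPath, Bool.false_eq_true, if_false]
      exact hrep _ _ _ (by decide) (by decide)
    · simp only [PotPos.runPath, if_true]
      refine hrep _ _ _ ?_ ?_ <;> split <;> decide
  · intro x hx y hy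
    rw [hhead y hy]
    simp only [PathRel] at h
    cases ε
    · simp only [PotPos.runPath, Bool.false_eq_true, if_false] at hx
      simp only [Bool.false_eq_true, false_and, false_or] at h
      rw [if_pos h.2]
      rcases hlast _ _ _ _ hx with ⟨h0, -⟩ | ⟨-, rfl⟩
      · omega
      · decide
    · simp only [PotPos.runPath, if_true] at hx
      rcases hlast _ _ _ _ hx with ⟨h0, rfl⟩ | ⟨h0, rfl⟩
      · rcases h with h | h
        · rw [if_pos h.2]; decide
        · omega
      · cases hq : q.1
        · simp only [hq, true_and, Bool.false_eq_true, false_or, or_false, and_true] at h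
          rw [if_pos (by omega : 0 ≤ k)]
          decide
        · by_cases h0k : 0 ≤ k
          · rw [if_pos h0k]; decide
          · rw [if_neg h0k]; decide

theorem map_runPath {p : Bool × ℤ} (h : p.1 = true ∨ 0 ≤ p.2) :
    (runPath p).map nodeLabel = runLetters p := by
  rcases p with ⟨ε, k⟩
  have l0 : nodeLabel 0 = (0, true) := rfl
  have l1 : nodeLabel 1 = (1, false) := rfl
  have l2 : nodeLabel 2 = (0, true) := rfl
  have l3 : nodeLabel 3 = (1, true) := rfl
  have l4 : nodeLabel 4 = (0, false) := rfl
  cases ε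
  · have hk : 0 ≤ k := by simpa using h
    simp [runPath, runLetters, l1, l2, hk]
  · by_cases hk : 0 ≤ k <;> simp [runPath, runLetters, l3, l0, l4, hk]

theorem flatMap_runLetters_mem_rinf {W : List (Bool × ℤ)}
    (h : Cycle.Chain PathRel (W : Cycle (Bool × ℤ))) : W.flatMap runLetters ∈ Rinf := by
  rw [mem_rinf_iff]
  refine ⟨W.flatMap runPath, chain_flatMap (fun p q hpq => hpq.runPath) h, ?_⟩
  rw [List.map_flatMap]
  refine List.flatMap_congr fun p hp => map_runPath ?_
  obtain ⟨q, hq⟩ := exists_succ h hp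
  rcases hq with hq | hq
  · exact Or.inl hq.1
  · exact Or.inr (by omega)

/-- Sequences of runs which start with the letter `b⁻¹` or are empty, and which satisfy
`RunRel K` if they are followed by the letter `b⁻¹`. -/
def NegRuns (K : ℕ) : Set (List (Bool × ℤ)) :=
  {W | headSign false W = false ∧ (W ++ [(false, 0)]).IsChain (RunRel K)}

/-- The exceptional case is two successive `b⁻¹`: after `b⁻¹` the letters `a` are read at node 2,
which leads only to itself and to node 3. -/
theorem RunRel.pathRel_or {N : ℕ} {p q : Bool × ℤ} (h : RunRel (N + 1) p q) :
    PathRel p q ∨ p.1 = false ∧ q.1 = false ∧ (N + 1 : ℤ) ≤ p.2 := by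
  rcases p with ⟨ε, k⟩
  rcases q with ⟨δ, l⟩
  revert h
  cases ε <;> cases δ <;> simp [RunRel, PathRel]

/-- `K` is the least exponent between two cyclically consecutive `b⁻¹`. As `K ≥ N + 1`, the lower
bound between two letters `b` may be weakened to `-(K + 1)`, so `RunRel K` holds throughout. The run
split off has `K + 1` letters, which yields the factor `x^K` in the count. -/
theorem mem_rinf_or_exists_negRuns {N : ℕ} {W : List (Bool × ℤ)}
    (h : Cycle.Chain (RunRel (N + 1)) (W : Cycle (Bool × ℤ))) :
    W.flatMap runLetters ∈ Rinf ∨ ∃ K : ℕ, 1 ≤ K ∧ ∃ W' ∈ NegRuns K, W ~r ((false, (K : ℤ)) :: W') := by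
  rw [cycle_chain_iff] at h
  by_cases hex : ∃ K : ℕ, ∃ L, W ~r ((false, (K : ℤ)) :: L) ∧ headSign false L = false
  · right
    classical
    obtain ⟨L, hL, hL2⟩ := Nat.find_spec hex
    have hmin := fun m => Nat.find_min' hex (m := m)
    set K := Nat.find hex
    have hKN : N + 1 ≤ K := by
      rcases L with _ | ⟨q, L⟩
      · have := h _ _ hL (false, (K : ℤ)) (by simp)
        simp [RunRel] at this
        omega
      · have := h _ _ hL q (by simp)
        simp only [headSign] at hL2
        simp [RunRel, hL2] at this
        omega
    refine ⟨K, by omega, L, ⟨hL2, ?_⟩, hL⟩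
    have hK : Cycle.Chain (RunRel K) (W : Cycle (Bool × ℤ)) := by
      rw [cycle_chain_iff]
      intro p L' hL' q hq
      have := h p L' hL' q hq
      rcases p with ⟨ε, k⟩
      rcases q with ⟨δ, l⟩
      cases ε <;> cases δ <;> simp only [RunRel, if_true, Bool.false_eq_true, if_false] at this ⊢
      · obtain ⟨n, rfl⟩ := Int.eq_ofNat_of_zero_le (by omega : 0 ≤ k)
        have := hmin n ⟨L', hL', by
          rcases L' with _ | ⟨q', L'⟩
          · rfl
          · simp at hq
            simp [headSign, hq]⟩
        exact_mod_cast this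
      · exact this
      · exact this
      · push_cast at this
        omega
    rw [Cycle.coe_eq_coe.2 hL, Cycle.chain_coe_cons] at hK
    have hK := hK.tail
    simp only [List.tail_cons] at hK
    rw [List.isChain_append] at hK ⊢
    refine ⟨hK.1, by simp, ?_⟩
    intro x hx y hy
    simp only [List.head?_cons, Option.mem_def, Option.some.injEq] at hy
    subst hy
    exact hK.2.2 x hx (false, (K : ℤ)) (by simp)
  · left
    refine flatMap_runLetters_mem_rinf ?_
    rw [cycle_chain_iff]
    intro p L hL q hq
    rcases (h p L hL q hq).pathRel_or with h1 | ⟨h1, h2, h3⟩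
    · exact h1
    · exfalso
      apply hex
      rcases p with ⟨ε, k⟩
      simp only at h1 h3
      subst h1
      obtain ⟨n, rfl⟩ := Int.eq_ofNat_of_zero_le (by omega : 0 ≤ k)
      refine ⟨n, L, hL, ?_⟩
      rcases L with _ | ⟨q', L'⟩
      · rfl
      · simp at hq
        simp [headSign, hq, h2]

/-! #### Potentially positive words, up to a permutation of the letters -/

theorem exists_letterPerm {σ : MulAut F2} (hσ : σ ∈ signedPerms) :
    ∃ τ : Equiv.Perm (Fin 2 × Bool), (∀ L, σ (FreeGroup.mk L) = FreeGroup.mk (L.map τ)) ∧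
      ∀ p q, NotCancel (τ p) (τ q) ↔ NotCancel p q := by
  have of_letter : ∀ (φ : MulAut F2) (τ : Equiv.Perm (Fin 2 × Bool)),
      (∀ p, φ (FreeGroup.mk [p]) = FreeGroup.mk [τ p]) →
      ∀ L, φ (FreeGroup.mk L) = FreeGroup.mk (L.map τ) := by
    intro φ τ h L
    induction L with
    | nil => simp [← FreeGroup.one_eq_mk]
    | cons p L ih =>
      rw [← List.singleton_append, ← FreeGroup.mul_mk, map_mul, ih, h, List.map_append,
        ← FreeGroup.mul_mk, List.map_singleton]
  induction hσ using Subgroup.closure_induction with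
  | mem x hx =>
    simp only [Set.mem_insert_iff, Set.mem_singleton_iff] at hx
    rcases hx with rfl | rfl
    · refine ⟨⟨swapLetter, swapLetter, fun _ => by simp [swapLetter],
        fun _ => by simp [swapLetter]⟩, autSwap_mk, ?_⟩
      rintro ⟨i, s⟩ ⟨j, t⟩
      simp [NotCancel, swapLetter]
    · refine ⟨⟨fun p => (p.1, if p.1 = 0 then !p.2 else p.2),
        fun p => (p.1, if p.1 = 0 then !p.2 else p.2), ?_, ?_⟩, of_letter _ _ ?_, ?_⟩
      · rintro ⟨i, s⟩
        by_cases h : i = 0 <;> simp [h]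
      · rintro ⟨i, s⟩
        by_cases h : i = 0 <;> simp [h]
      · have of_true : ∀ i : Fin 2, FreeGroup.mk [(i, true)] = FreeGroup.of i := fun _ => rfl
        have of_false : ∀ i : Fin 2, FreeGroup.mk [(i, false)] = (FreeGroup.of i)⁻¹ := fun _ => rfl
        rintro ⟨i, s⟩
        fin_cases i <;> cases s <;> simp [of_true, of_false]
      · rintro ⟨i, s⟩ ⟨j, t⟩
        fin_cases i <;> fin_cases j <;> cases s <;> cases t <;> simp [NotCancel]
  | one => exact ⟨1, by simp, by simp⟩
  | mul x y hx hy ihx ihy =>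
    obtain ⟨τ, h1, h2⟩ := ihx
    obtain ⟨τ', h1', h2'⟩ := ihy
    refine ⟨τ * τ', ?_, ?_⟩
    · intro L
      rw [MulAut.mul_apply, h1', h1, List.map_map]
      rfl
    · intro p q
      rw [Equiv.Perm.mul_apply, Equiv.Perm.mul_apply, h2, h2']
  | inv x hx ihx =>
    obtain ⟨τ, h1, h2⟩ := ihx
    refine ⟨τ⁻¹, ?_, ?_⟩
    · intro L
      rw [MulAut.inv_apply, MulEquiv.symm_apply_eq, h1, List.map_map]
      have : (τ ∘ ⇑τ⁻¹) = id := by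
        ext1 x
        simp
      rw [this, List.map_id]
    · intro p q
      rw [← h2, ← Equiv.Perm.mul_apply, ← Equiv.Perm.mul_apply, mul_inv_cancel, Equiv.Perm.one_apply,
        Equiv.Perm.one_apply]

theorem replicate_mem_rinf (s : Bool) (n : ℕ) : List.replicate n (0, s) ∈ Rinf := by
  rw [mem_rinf_iff]
  have key : ∀ x : Fin 5, Edge x x → Cycle.Chain Edge (List.replicate n x : Cycle (Fin 5)) := by
    intro x hx
    refine Cycle.chain_of_pairwise fun p hp q hq => ?_
    rw [Cycle.mem_coe_iff] at hp hq
    rwa [List.eq_of_mem_replicate hp, List.eq_of_mem_replicate hq]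
  cases s
  · exact ⟨List.replicate n 4, key 4 (by decide), by rw [List.map_replicate]; rfl⟩
  · exact ⟨List.replicate n 0, key 0 (by decide), by rw [List.map_replicate]; rfl⟩

theorem isCyclicallyReduced_flatMap_runLetters {R : Bool × ℤ → Bool × ℤ → Prop}
    (hR : ∀ p q, R p q → (p.1 = true ∧ q.1 = true) ∨ 1 ≤ p.2) {W : List (Bool × ℤ)}
    (h : Cycle.Chain R (W : Cycle (Bool × ℤ))) :
    FreeGroup.IsCyclicallyReduced (W.flatMap runLetters) := by
  rw [isCyclicallyReduced_iff_chain]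
  exact (chain_flatMap (fun p q hpq => runLetters_isolatedB (hR p q hpq)) h).imp
    fun p q hpq => hpq.1

/-- A potentially positive cyclically reduced word belongs, up to a permutation of the letters,
to the language of the automaton or to one of the sparse families given by `NegRuns`. -/
theorem exists_perm_of_mem_PP {w : List (Fin 2 × Bool)} (hw : w ∈ PP 2) :
    ∃ τ : Equiv.Perm (Fin 2 × Bool), w.map τ ∈ Rinf ∨
      ∃ K : ℕ, 1 ≤ K ∧ ∃ W ∈ NegRuns K,
        w.map τ ~r ((false, (K : ℤ)) :: W).flatMap runLetters := by
  obtain ⟨hred, hpp⟩ := hw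
  obtain ⟨σ, hσ, h⟩ := hpp.exists_signedPerm
  obtain ⟨τ, hτ, hτ'⟩ := exists_letterPerm hσ
  have hred' : FreeGroup.IsCyclicallyReduced (w.map τ) := by
    rw [isCyclicallyReduced_iff_chain] at hred ⊢
    rw [← Cycle.map_coe, Cycle.chain_map]
    exact hred.imp fun p q h => (hτ' p q).2 h
  refine ⟨τ, ?_⟩
  rw [hτ] at h
  rcases h with (⟨k, hk⟩ | ⟨W, hW, hk⟩) | ⟨N, W, -, hW, hk⟩
  · left
    rw [← mk_replicate_natAbs] at hk
    have hr := isRotated_of_isConj hred'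
      (isCyclicallyReduced_of_mem_rinf (replicate_mem_rinf _ _)) hk
    exact rinf_of_isRotated hr.symm (replicate_mem_rinf _ _)
  · left
    have hc : Cycle.Chain PathRel (W : Cycle (Bool × ℤ)) :=
      Cycle.chain_of_pairwise fun p hp q hq => Or.inl ⟨hW p hp, hW q hq⟩
    have hmem := flatMap_runLetters_mem_rinf hc
    rw [← mk_flatMap_runLetters] at hk
    exact rinf_of_isRotated
      (isRotated_of_isConj hred' (isCyclicallyReduced_of_mem_rinf hmem) hk).symm hmem
  · rw [← mk_flatMap_runLetters] at hk
    have hr := isRotated_of_isConj hred'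
      (isCyclicallyReduced_flatMap_runLetters (fun p q hpq => hpq.pos_or) hW) hk
    rcases mem_rinf_or_exists_negRuns hW with h | ⟨K, hK, W', hW', hrot⟩
    · exact Or.inl (rinf_of_isRotated hr.symm h)
    · refine Or.inr ⟨K, hK, W', hW', hr.trans ?_⟩
      obtain ⟨n, hn⟩ := hrot
      rw [← hn]
      clear hn hk hr hW hW'
      induction n generalizing W with
      | zero => rw [List.rotate_zero]
      | succ n ih =>
        rcases W with _ | ⟨p, W⟩
        · simp
        · rw [List.rotate_cons_succ]
          refine List.IsRotated.trans ?_ (ih (W := W ++ [p]))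
          rw [List.flatMap_append, List.flatMap_cons, List.flatMap_singleton]
          exact List.isRotated_append

end Language

/-! ### Counting sequences of runs -/

section Counting

/-- The number of letters of a sequence of runs. -/
def runsLength (W : List (Bool × ℤ)) : ℕ := (W.flatMap runLetters).length

@[simp] theorem runsLength_nil : runsLength [] = 0 := rfl

@[simp] theorem runsLength_cons (p : Bool × ℤ) (W : List (Bool × ℤ)) :
    runsLength (p :: W) = 1 + p.2.natAbs + runsLength W := by
  simp [runsLength, runLetters]
  ring

theorem finite_runsLength (m : ℕ) : {W : List (Bool × ℤ) | runsLength W = m}.Finite := by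
  induction m using Nat.strong_induction_on with
  | _ m ih =>
    have hfin : (⋃ p ∈ (Finset.univ ×ˢ Finset.Icc (-(m : ℤ)) m : Finset (Bool × ℤ)),
        ⋃ i ∈ Finset.range m, (List.cons p) '' {W | runsLength W = i}).Finite := by
      refine Set.Finite.biUnion (Finset.finite_toSet _) fun p _ => ?_
      refine Set.Finite.biUnion (Finset.finite_toSet _) fun i hi => ?_
      exact (ih i (Finset.mem_range.1 hi)).image _
    refine (hfin.union (Set.finite_singleton [])).subset ?_
    intro W hW
    rcases W with _ | ⟨p, W⟩
    · right; rfl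
    · left
      have hW : 1 + p.2.natAbs + runsLength W = m := by
        rw [← runsLength_cons]; exact hW
      simp only [Set.mem_iUnion]
      refine ⟨p, ?_, runsLength W, by simp only [Finset.mem_range]; omega, W, rfl, rfl⟩
      simp only [Finset.mem_product, Finset.mem_univ, Finset.mem_Icc, true_and]
      omega

theorem sum_pow_natAbs_le {y : ℝ} (hy0 : 0 < y) (hy1 : y < 1) (j : ℕ) (I : Finset ℤ)
    (hI : ∀ k ∈ I, (j : ℤ) ≤ k) : ∑ k ∈ I, y ^ k.natAbs ≤ y ^ j / (1 - y) := by
  have hinj : Set.InjOn Int.natAbs (I : Set ℤ) := by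
    intro a ha b hb h
    have h1 := hI a ha
    have h2 := hI b hb
    omega
  rw [← Finset.sum_image (f := fun i => y ^ i) (g := Int.natAbs) hinj]
  set J := I.image Int.natAbs with hJ
  have hsub : J ⊆ Finset.Ico j (J.sup id + 1 + j) := by
    intro i hi
    have h1 : i ≤ J.sup id := Finset.le_sup (f := id) hi
    rw [hJ, Finset.mem_image] at hi
    obtain ⟨k, hk, rfl⟩ := hi
    have := hI k hk
    rw [Finset.mem_Ico]
    omega
  refine (Finset.sum_le_sum_of_subset_of_nonneg hsub fun i _ _ => by positivity).trans ?_
  exact geom_sum_Ico_le_of_lt_one hy0.le hy1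

theorem sum_pow_natAbs_neg_le {y : ℝ} (hy0 : 0 < y) (hy1 : y < 1) (j : ℕ) (I : Finset ℤ)
    (hI : ∀ k ∈ I, -(j : ℤ) ≤ k ∧ k < 0) :
    ∑ k ∈ I, y ^ k.natAbs ≤ (y - y ^ (j + 1)) / (1 - y) := by
  have hinj : Set.InjOn Int.natAbs (I : Set ℤ) := by
    intro a ha b hb h
    have h1 := hI a ha
    have h2 := hI b hb
    omega
  rw [← Finset.sum_image (f := fun i => y ^ i) (g := Int.natAbs) hinj]
  have hsub : I.image Int.natAbs ⊆ Finset.Ico 1 (j + 1) := by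
    intro i hi
    rw [Finset.mem_image] at hi
    obtain ⟨k, hk, rfl⟩ := hi
    have := hI k hk
    rw [Finset.mem_Ico]
    omega
  refine (Finset.sum_le_sum_of_subset_of_nonneg hsub fun i _ _ => by positivity).trans ?_
  rw [geom_sum_Ico' hy1.ne (by omega), pow_one]

/-- The weight of a sequence of runs with first sign `ε`. -/
noncomputable def signWeight (K : ℕ) (y : ℝ) (ε : Bool) : ℝ :=
  if ε then 1 - y - y ^ (K + 1) else y ^ 2

-- The weights are a supersolution for the transfer matrix on signs, whose entries are the
-- generating functions of the admissible exponents. With the full geometric series the row of `b⁻¹`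
-- is an equality, and the row of `b` is then `hdet`, the nonnegativity of the determinant of
-- identity minus matrix after clearing denominators.
open Classical in
theorem sum_signWeight_le {K m : ℕ} {y : ℝ} (hy0 : 0 < y) (hy1 : y < 1)
    (hv : 0 ≤ 1 - y - y ^ (K + 1))
    (hdet : y ^ 4 ≤ (1 - 2 * y - y ^ 2 + y ^ (K + 3)) * (1 - y - y ^ (K + 1))) (ε : Bool) :
    ∑ δ : Bool, ∑ k ∈ (Finset.Icc (-(m : ℤ)) m).filter (fun k => RunRel K (ε, k) (δ, 0)),
      y ^ (1 + k.natAbs) * signWeight K y δ ≤ signWeight K y ε := by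
  have h1y : 0 < 1 - y := by linarith
  have hsum : ∀ I : Finset ℤ, ∀ c : ℝ, ∑ k ∈ I, y ^ (1 + k.natAbs) * c =
      y * c * ∑ k ∈ I, y ^ k.natAbs := by
    intro I c
    rw [Finset.mul_sum]
    exact Finset.sum_congr rfl fun k _ => by rw [pow_add, pow_one]; ring
  simp only [hsum, Fintype.sum_bool]
  cases ε
  · have b1 := sum_pow_natAbs_le hy0 hy1 1
      ((Finset.Icc (-(m : ℤ)) m).filter (fun k => RunRel K (false, k) (true, 0)))
      (by intro k hk; simpa [RunRel] using (Finset.mem_filter.1 hk).2)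
    have b2 := sum_pow_natAbs_le hy0 hy1 K
      ((Finset.Icc (-(m : ℤ)) m).filter (fun k => RunRel K (false, k) (false, 0)))
      (by intro k hk; simpa [RunRel] using (Finset.mem_filter.1 hk).2)
    simp only [signWeight, if_true, Bool.false_eq_true, if_false]
    calc _ ≤ y * (1 - y - y ^ (K + 1)) * (y ^ 1 / (1 - y)) + y * y ^ 2 * (y ^ K / (1 - y)) := by
          gcongr
      _ = y ^ 2 := by field_simp; ring
  · have b1 : ∑ k ∈ (Finset.Icc (-(m : ℤ)) m).filter (fun k => RunRel K (true, k) (true, 0)),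
        y ^ k.natAbs ≤ y ^ 0 / (1 - y) + (y - y ^ (K + 1 + 1)) / (1 - y) := by
      rw [← Finset.sum_filter_add_sum_filter_not _ (fun k : ℤ => 0 ≤ k)]
      refine add_le_add (sum_pow_natAbs_le hy0 hy1 0 _ ?_) (sum_pow_natAbs_neg_le hy0 hy1 _ _ ?_)
      · intro k hk
        simpa using (Finset.mem_filter.1 hk).2
      · intro k hk
        simp only [RunRel, Finset.mem_filter, if_true] at hk
        push_cast
        omega
    have b2 := sum_pow_natAbs_le hy0 hy1 1
      ((Finset.Icc (-(m : ℤ)) m).filter (fun k => RunRel K (true, k) (false, 0)))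
      (by intro k hk; simpa [RunRel] using (Finset.mem_filter.1 hk).2)
    simp only [signWeight, if_true, Bool.false_eq_true, if_false]
    calc _ ≤ y * (1 - y - y ^ (K + 1)) * (y ^ 0 / (1 - y) + (y - y ^ (K + 1 + 1)) / (1 - y)) +
          y * y ^ 2 * (y ^ 1 / (1 - y)) := by
          gcongr
      _ = ((y + y ^ 2 - y ^ (K + 3)) * (1 - y - y ^ (K + 1)) + y ^ 4) / (1 - y) := by
          field_simp; ring
      _ ≤ 1 - y - y ^ (K + 1) := by
          rw [div_le_iff₀ h1y]
          linarith

/-- Induction on the length by removing the first run. The factor `y ^ 2` is the weight of the sign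
of `b⁻¹`, which is the default head sign of the empty sequence. -/
theorem card_runs_le {K : ℕ} {y : ℝ} (hy0 : 0 < y) (hy1 : y < 1)
    (hv : 0 ≤ 1 - y - y ^ (K + 1))
    (hdet : y ^ 4 ≤ (1 - 2 * y - y ^ 2 + y ^ (K + 3)) * (1 - y - y ^ (K + 1))) (m : ℕ) (ε : Bool)
    (S : Finset (List (Bool × ℤ)))
    (hS : ∀ W ∈ S, headSign false W = ε ∧ (W ++ [(false, 0)]).IsChain (RunRel K) ∧
      runsLength W = m) :
    (S.card : ℝ) * y ^ m * y ^ 2 ≤ signWeight K y ε := by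
  classical
  have hw0 : ∀ δ, 0 ≤ signWeight K y δ := by
    intro δ
    cases δ
    · simp only [signWeight, Bool.false_eq_true, if_false]; positivity
    · simpa [signWeight] using hv
  induction m using Nat.strong_induction_on generalizing ε S with
  | _ m ih =>
    rcases Nat.eq_zero_or_pos m with rfl | hm
    · have hnil : ∀ W ∈ S, W = [] := by
        intro W hW
        have := (hS W hW).2.2
        rcases W with _ | ⟨p, W⟩
        · rfl
        · rw [runsLength_cons] at this; omega
      rcases S.eq_empty_or_nonempty with rfl | ⟨W, hW⟩
      · simpa using hw0 ε
      · have hε := (hS W hW).1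
        rw [hnil W hW] at hε
        have hε : false = ε := hε
        subst hε
        have hcard : S.card ≤ 1 := Finset.card_le_one.2 fun a ha b hb => by
          rw [hnil a ha, hnil b hb]
        have : (S.card : ℝ) ≤ 1 := by exact_mod_cast hcard
        simp only [signWeight, Bool.false_eq_true, if_false, pow_zero, mul_one]
        nlinarith [sq_nonneg y]
    · let f : List (Bool × ℤ) → Bool × ℤ := fun W =>
        (headSign false W.tail, (W.head?.map Prod.snd).getD 0)
      have hcons : ∀ W ∈ S, ∃ k W', W = (ε, k) :: W' ∧ RunRel K (ε, k) (headSign false W', 0) ∧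
          (W' ++ [(false, 0)]).IsChain (RunRel K) ∧ 1 + k.natAbs + runsLength W' = m := by
        intro W hW
        obtain ⟨h1, h2, h3⟩ := hS W hW
        rcases W with _ | ⟨⟨δ, k⟩, W'⟩
        · simp at h3; omega
        · have h1 : δ = ε := h1
          subst h1
          rw [runsLength_cons] at h3
          refine ⟨k, W', rfl, ?_, h2.tail, h3⟩
          rcases W' with _ | ⟨q, W'⟩
          · simpa [headSign] using h2
          · rw [List.cons_append, List.cons_append, List.isChain_cons_cons] at h2
            exact h2.1
      let I : Finset (Bool × ℤ) := (Finset.univ ×ˢ Finset.Icc (-(m : ℤ)) m).filter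
        (fun p => RunRel K (ε, p.2) (p.1, 0))
      have hmaps : ∀ W ∈ S, f W ∈ I := by
        intro W hW
        obtain ⟨k, W', rfl, h1, -, h3⟩ := hcons W hW
        simp only [I, f, Finset.mem_filter, Finset.mem_product, Finset.mem_univ, true_and,
          Finset.mem_Icc, List.tail_cons, List.head?_cons, Option.map_some, Option.getD_some]
        exact ⟨by omega, h1⟩
      have hfib : ∀ p ∈ I, ((S.filter (fun W => f W = p)).card : ℝ) * y ^ m * y ^ 2 ≤
          y ^ (1 + p.2.natAbs) * signWeight K y p.1 := by
        rintro ⟨δ, k⟩ hp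
        set T := S.filter (fun W => f W = (δ, k)) with hT
        have hTc : ∀ W ∈ T, ∃ W', W = (ε, k) :: W' ∧ headSign false W' = δ ∧
            (W' ++ [(false, 0)]).IsChain (RunRel K) ∧ 1 + k.natAbs + runsLength W' = m := by
          intro W hW
          obtain ⟨hW, hf⟩ := Finset.mem_filter.1 hW
          obtain ⟨k', W', rfl, h1, h2, h3⟩ := hcons W hW
          simp only [f, List.tail_cons, List.head?_cons, Option.map_some, Option.getD_some,
            Prod.mk.injEq] at hf
          obtain ⟨hf1, rfl⟩ := hf
          exact ⟨W', rfl, hf1, h2, h3⟩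
        rcases T.eq_empty_or_nonempty with h0 | ⟨W0, hW0⟩
        · rw [h0]
          simp only [Finset.card_empty, Nat.cast_zero, zero_mul]
          exact mul_nonneg (by positivity) (hw0 δ)
        · obtain ⟨W0', -, -, -, hlen⟩ := hTc W0 hW0
          have hcard : (T.image List.tail).card = T.card := by
            refine Finset.card_image_of_injOn ?_
            intro A hA B hB hAB
            obtain ⟨A', rfl, -⟩ := hTc A hA
            obtain ⟨B', rfl, -⟩ := hTc B hB
            simp only [List.tail_cons] at hAB
            rw [hAB]
          have := ih (m - (1 + k.natAbs)) (by omega) δ (T.image List.tail) (by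
            intro W hW
            obtain ⟨A, hA, rfl⟩ := Finset.mem_image.1 hW
            obtain ⟨A', rfl, h1, h2, h3⟩ := hTc A hA
            exact ⟨h1, h2, by simp only [List.tail_cons]; omega⟩)
          rw [hcard] at this
          have hpow : y ^ m = y ^ (1 + k.natAbs) * y ^ (m - (1 + k.natAbs)) := by
            rw [← pow_add]; congr 1; omega
          calc (T.card : ℝ) * y ^ m * y ^ 2
              = y ^ (1 + k.natAbs) * ((T.card : ℝ) * y ^ (m - (1 + k.natAbs)) * y ^ 2) := by
                rw [hpow]; ring
            _ ≤ _ := by gcongr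
      have hcard : (S.card : ℝ) = ∑ p ∈ I, ((S.filter (fun W => f W = p)).card : ℝ) := by
        rw [Finset.card_eq_sum_card_fiberwise hmaps]
        push_cast
        rfl
      calc (S.card : ℝ) * y ^ m * y ^ 2
          = ∑ p ∈ I, ((S.filter (fun W => f W = p)).card : ℝ) * y ^ m * y ^ 2 := by
            rw [hcard, Finset.sum_mul, Finset.sum_mul]
        _ ≤ ∑ p ∈ I, y ^ (1 + p.2.natAbs) * signWeight K y p.1 := Finset.sum_le_sum hfib
        _ = ∑ δ : Bool, ∑ k ∈ (Finset.Icc (-(m : ℤ)) m).filter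
              (fun k => RunRel K (ε, k) (δ, 0)), y ^ (1 + k.natAbs) * signWeight K y δ := by
            simp only [I, Finset.sum_filter, Finset.sum_product]
        _ ≤ _ := sum_signWeight_le hy0 hy1 hv hdet ε

/-- The sequences of runs in `NegRuns K` with `m` letters. -/
noncomputable def negRunsFinset (K m : ℕ) : Finset (List (Bool × ℤ)) :=
  ((finite_runsLength m).inter_of_right (NegRuns K)).toFinset

theorem mem_negRunsFinset {K m : ℕ} {W : List (Bool × ℤ)} :
    W ∈ negRunsFinset K m ↔ W ∈ NegRuns K ∧ runsLength W = m := by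
  simp [negRunsFinset]

theorem card_negRunsFinset_le {K : ℕ} {y : ℝ} (hy0 : 0 < y) (hy1 : y < 1)
    (hv : 0 ≤ 1 - y - y ^ (K + 1))
    (hdet : y ^ 4 ≤ (1 - 2 * y - y ^ 2 + y ^ (K + 3)) * (1 - y - y ^ (K + 1))) (m : ℕ) :
    ((negRunsFinset K m).card : ℝ) * y ^ m ≤ 1 := by
  have := card_runs_le hy0 hy1 hv hdet m false (negRunsFinset K m) (by
    intro W hW
    obtain ⟨⟨h1, h2⟩, h3⟩ := mem_negRunsFinset.1 hW
    exact ⟨h1, h2, h3⟩)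
  simp only [signWeight, Bool.false_eq_true, if_false] at this
  have h2 : 0 < y ^ 2 := by positivity
  nlinarith

/-! #### The growth functions -/

theorem finite_growth {A : Type*} [Finite A] (S : Set (List A)) (n : ℕ) :
    {w : List A | w ∈ S ∧ w.length = n}.Finite :=
  (List.finite_length_eq A n).subset fun _ h => h.2

/-- The factors account for the permutation of letters and the rotation; `K + 1` letters are used by
the run `b⁻¹a^K`. -/
theorem growth_PP_le (n : ℕ) : growth (PP 2) n ≤
    Fintype.card (Equiv.Perm (Fin 2 × Bool)) * (growth Rinf n +
      n * ∑ K ∈ Finset.Ico 1 n, (negRunsFinset K (n - (K + 1))).card) := by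
  classical
  let R : Finset (List (Fin 2 × Bool)) := (finite_growth Rinf n).toFinset
  let B : Finset (List (Fin 2 × Bool)) := (Finset.range n).biUnion fun r =>
    (Finset.Ico 1 n).biUnion fun K => (negRunsFinset K (n - (K + 1))).image fun W =>
      (((false, (K : ℤ)) :: W).flatMap runLetters).rotate r
  let A : Finset (List (Fin 2 × Bool)) :=
    (Finset.univ : Finset (Equiv.Perm (Fin 2 × Bool))).biUnion fun τ =>
      (R ∪ B).image (List.map τ)
  have hsub : (finite_growth (PP 2) n).toFinset ⊆ A := by
    intro w hw
    simp only [Set.Finite.mem_toFinset, Set.mem_ofPred_eq] at hw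
    obtain ⟨hw, hlen⟩ := hw
    obtain ⟨τ, h⟩ := exists_perm_of_mem_PP hw
    simp only [A, Finset.mem_biUnion, Finset.mem_univ, true_and, Finset.mem_image]
    refine ⟨τ⁻¹, w.map τ, ?_, ?_⟩
    · rw [Finset.mem_union]
      rcases h with h | ⟨K, hK, W, hW, hrot⟩
      · left
        simp only [R, Set.Finite.mem_toFinset, Set.mem_ofPred_eq]
        exact ⟨h, by simpa using hlen⟩
      · right
        have hl : 1 + K + runsLength W = n := by
          have := hrot.perm.length_eq
          rw [List.length_map, hlen] at this
          rw [this]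
          have h2 := runsLength_cons (false, (K : ℤ)) W
          simp only [Int.natAbs_natCast] at h2
          exact h2.symm
        simp only [B, Finset.mem_biUnion, Finset.mem_range, Finset.mem_image, Finset.mem_Ico]
        obtain ⟨r, hr⟩ := hrot.symm
        refine ⟨r % n, Nat.mod_lt _ (by omega), K, ⟨hK, by omega⟩, W, ?_, ?_⟩
        · exact mem_negRunsFinset.2 ⟨hW, by omega⟩
        · rw [← hr]
          have : (((false, (K : ℤ)) :: W).flatMap runLetters).length = n := by
            have h2 := runsLength_cons (false, (K : ℤ)) W
            simp only [Int.natAbs_natCast] at h2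
            rw [← hl]
            exact h2
          nth_rw 2 [← List.rotate_mod]
          rw [this]
    · rw [List.map_map]
      have : (⇑τ⁻¹ ∘ τ) = id := by ext1 x; simp
      rw [this, List.map_id]
  have hB : B.card ≤ n * ∑ K ∈ Finset.Ico 1 n, (negRunsFinset K (n - (K + 1))).card := by
    refine (Finset.card_biUnion_le_card_mul _ _ _ fun r _ => ?_).trans_eq
      (by rw [Finset.card_range])
    exact Finset.card_biUnion_le.trans (Finset.sum_le_sum fun K _ => Finset.card_image_le)
  have hR : R.card = growth Rinf n := by
    rw [growth, Set.ncard_eq_toFinset_card _ (finite_growth Rinf n)]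
  rw [growth, Set.ncard_eq_toFinset_card _ (finite_growth (PP 2) n)]
  refine (Finset.card_le_card hsub).trans ?_
  refine (Finset.card_biUnion_le_card_mul _ _ (R.card + B.card) fun τ _ => ?_).trans ?_
  · exact Finset.card_image_le.trans (Finset.card_union_le _ _)
  · rw [Finset.card_univ, hR]
    gcongr

/-! ### Lower bound for the growth of `Rinf`. -/

/-- The words read along the paths of the automaton with `n` edges from the node `s` to the node
labeled `b`. -/
def pathWords : ℕ → Fin 5 → Finset (List (Fin 2 × Bool))
  | 0, s => if s = 3 then {[]} else ∅
  | n + 1, s => (Finset.univ.filter (Edge s)).biUnion fun s' =>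
      (pathWords n s').image (List.cons (nodeLabel s'))

theorem edge_label_injective : ∀ s i j : Fin 5, Edge s i → Edge s j → nodeLabel i = nodeLabel j →
    i = j := by
  decide

/-- Successors of a node carry distinct labels, so words from a given node are counted like paths.
-/
theorem card_pathWords_succ (n : ℕ) (s : Fin 5) : (pathWords (n + 1) s).card =
    ∑ s' ∈ Finset.univ.filter (Edge s), (pathWords n s').card := by
  rw [pathWords, Finset.card_biUnion]
  · exact Finset.sum_congr rfl fun s' _ =>
      Finset.card_image_of_injective _ (List.cons_injective)
  · intro i hi j hj hij
    rw [Finset.mem_coe, Finset.mem_filter] at hi hj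
    refine Finset.disjoint_left.2 fun w hw hw' => ?_
    obtain ⟨u, -, rfl⟩ := Finset.mem_image.1 hw
    obtain ⟨u', -, h⟩ := Finset.mem_image.1 hw'
    exact hij (edge_label_injective s i j hi.2 hj.2 (List.cons.inj h).1.symm)

theorem exists_path_of_mem_pathWords {n : ℕ} {s : Fin 5} {w : List (Fin 2 × Bool)}
    (h : w ∈ pathWords n s) : w.length = n ∧ ∃ p : List (Fin 5), (s :: p).IsChain Edge ∧
      (s :: p).getLast? = some 3 ∧ p.map nodeLabel = w := by
  induction n generalizing s w with
  | zero =>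
    rw [pathWords] at h
    by_cases hs : s = 3
    · rw [if_pos hs, Finset.mem_singleton] at h
      subst h hs
      exact ⟨rfl, [], by simp, by simp, rfl⟩
    · rw [if_neg hs] at h
      simp at h
  | succ n ih =>
    simp only [pathWords, Finset.mem_biUnion, Finset.mem_filter, Finset.mem_univ, true_and,
      Finset.mem_image] at h
    obtain ⟨s', hs', u, hu, rfl⟩ := h
    obtain ⟨h1, p, h2, h3, h4⟩ := ih hu
    refine ⟨by simp [h1], s' :: p, ?_, ?_, ?_⟩
    · exact List.isChain_cons_cons.2 ⟨hs', h2⟩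
    · simpa using h3
    · rw [List.map_cons, h4]

theorem pathWords_subset (n : ℕ) : (pathWords (n + 1) 3 : Set (List (Fin 2 × Bool))) ⊆
    {w | w ∈ Rinf ∧ w.length = n + 1} := by
  intro w hw
  obtain ⟨h1, p, h2, h3, h4⟩ := exists_path_of_mem_pathWords hw
  refine ⟨mem_rinf_iff.2 ⟨p, ?_, h4⟩, h1⟩
  rcases List.eq_nil_or_concat' p with rfl | ⟨p, x, rfl⟩
  · rw [← h4] at h1
    simp at h1
  · have hx : x = 3 := by
      rw [← List.cons_append, List.getLast?_concat] at h3
      simpa using h3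
    subst hx
    have hrot : (p ++ [3]) ~r (3 :: p) := by
      simpa using (List.isRotated_append (l := p) (l' := [(3 : Fin 5)]))
    rw [Cycle.coe_eq_coe.2 hrot, Cycle.chain_coe_cons]
    exact h2

/-- An eigenvector of the transition matrix of the automaton. -/
noncomputable def nodeWeight (x : ℝ) : Fin 5 → ℝ :=
  ![x * (1 - x) + x ^ 3, x ^ 2 * (1 - x), x * (1 - x), (1 - x) ^ 2, x * (1 - x)]

/-- Every row is an equality; only the row of node 3 uses the equation for `x`, which makes `1/x` an
eigenvalue. -/
theorem nodeWeight_le {x : ℝ}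
    (hx : x ^ 4 - x ^ 3 - x ^ 2 + 3 * x - 1 = 0) (s : Fin 5) :
    nodeWeight x s ≤ x * ∑ s' ∈ Finset.univ.filter (Edge s), nodeWeight x s' := by
  have f0 : Finset.univ.filter (Edge 0) = {0, 1, 3} := by decide
  have f1 : Finset.univ.filter (Edge 1) = {2} := by decide
  have f2 : Finset.univ.filter (Edge 2) = {2, 3} := by decide
  have f3 : Finset.univ.filter (Edge 3) = {3, 0, 4} := by decide
  have f4 : Finset.univ.filter (Edge 4) = {4, 3} := by decide
  have w0 : nodeWeight x 0 = x * (1 - x) + x ^ 3 := rfl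
  have w1 : nodeWeight x 1 = x ^ 2 * (1 - x) := rfl
  have w2 : nodeWeight x 2 = x * (1 - x) := rfl
  have w3 : nodeWeight x 3 = (1 - x) ^ 2 := rfl
  have w4 : nodeWeight x 4 = x * (1 - x) := rfl
  obtain rfl | rfl | rfl | rfl | rfl : s = 0 ∨ s = 1 ∨ s = 2 ∨ s = 3 ∨ s = 4 := by omega
  · rw [f0, Finset.sum_insert (by decide), Finset.sum_insert (by decide), Finset.sum_singleton,
      w0, w1, w3]
    linarith [show x * (1 - x) + x ^ 3 = x * (x * (1 - x) + x ^ 3 + (x ^ 2 * (1 - x) +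
      (1 - x) ^ 2)) by ring]
  · rw [f1, Finset.sum_singleton, w1, w2]
    exact le_of_eq (by ring)
  · rw [f2, Finset.sum_insert (by decide), Finset.sum_singleton, w2, w3]
    exact le_of_eq (by ring)
  · rw [f3, Finset.sum_insert (by decide), Finset.sum_insert (by decide), Finset.sum_singleton,
      w0, w3, w4]
    refine le_of_eq ?_
    linear_combination -hx
  · rw [f4, Finset.sum_insert (by decide), Finset.sum_singleton, w3, w4]
    exact le_of_eq (by ring)

theorem nodeWeight_le_card {x : ℝ} (hx0 : 0 ≤ x) (hx1 : x ≤ 1)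
    (hx : x ^ 4 - x ^ 3 - x ^ 2 + 3 * x - 1 = 0) (n : ℕ) (s : Fin 5) :
    nodeWeight x s ≤ (pathWords (n + 2) s).card * x ^ n := by
  induction n generalizing s with
  | zero =>
    -- Node 3 can be reached from every node in exactly two edges, but not from node 1 in a single
    -- edge; hence the shift by 2.
    have h1 : 1 ≤ (pathWords 2 s).card := by revert s; decide
    have h1' : (1 : ℝ) ≤ (pathWords 2 s).card := by exact_mod_cast h1
    have h2 : nodeWeight x s ≤ 1 := by
      obtain rfl | rfl | rfl | rfl | rfl : s = 0 ∨ s = 1 ∨ s = 2 ∨ s = 3 ∨ s = 4 := by omega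
      · change x * (1 - x) + x ^ 3 ≤ 1
        nlinarith [mul_nonneg hx0 (sub_nonneg.2 hx1), pow_le_one₀ hx0 hx1 (n := 2)]
      · change x ^ 2 * (1 - x) ≤ 1; nlinarith [mul_nonneg hx0 (sub_nonneg.2 hx1)]
      · change x * (1 - x) ≤ 1; nlinarith
      · change (1 - x) ^ 2 ≤ 1; nlinarith
      · change x * (1 - x) ≤ 1; nlinarith
    rw [pow_zero, mul_one]
    linarith
  | succ n ih =>
    refine (nodeWeight_le hx s).trans ?_
    rw [show n + 1 + 2 = (n + 2) + 1 from rfl, card_pathWords_succ]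
    push_cast
    rw [Finset.mul_sum, Finset.sum_mul]
    refine Finset.sum_le_sum fun s' _ => ?_
    calc x * nodeWeight x s' ≤ x * ((pathWords (n + 2) s').card * x ^ n) := by
          gcongr
          exact ih s'
      _ = _ := by ring

theorem le_growth_rinf {x : ℝ} (hx0 : 0 ≤ x) (hx1 : x ≤ 1)
    (hx : x ^ 4 - x ^ 3 - x ^ 2 + 3 * x - 1 = 0) (n : ℕ) :
    (1 - x) ^ 2 ≤ (growth Rinf (n + 2) : ℝ) * x ^ n := by
  refine (nodeWeight_le_card hx0 hx1 hx n 3).trans ?_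
  gcongr
  have := Set.ncard_le_ncard (pathWords_subset (n + 1)) (finite_growth Rinf (n + 2))
  rwa [Set.ncard_coe_finset] at this

end Counting

/-! ### Comparison of the growth functions -/

section Comparison

/-- The equation is also the limit, as `K → ∞`, of the equality case of the determinant condition
`hdet`. The interval is narrow because `perturbed_inequalities` has little room. -/
theorem exists_inverse_growthRate :
    ∃ x : ℝ, 0.399 ≤ x ∧ x ≤ 0.4 ∧ x ^ 4 - x ^ 3 - x ^ 2 + 3 * x - 1 = 0 := by
  have hcont : ContinuousOn (fun x : ℝ => x ^ 4 - x ^ 3 - x ^ 2 + 3 * x - 1)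
      (Set.Icc 0.399 0.4) := by fun_prop
  obtain ⟨x, hx, h⟩ := intermediate_value_Icc (by norm_num) hcont
    (show (0 : ℝ) ∈ Set.Icc _ _ by constructor <;> norm_num)
  exact ⟨x, hx.1, hx.2, h⟩

variable {x : ℝ}

/-- With `z = y^(K+1)`, the determinant splits into the limiting polynomial, which vanishes at `x`
and has decreased by at most `3(y - x) ≤ 0.006 x^K`, and `z` times a factor at least 0.016, which is
at least `0.016 · 0.399 x^K`. The divisor 200 makes the gain outweigh the loss. -/
theorem perturbed_inequalities (hx0 : 0.399 ≤ x) (hx1 : x ≤ 0.4)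
    (hx : x ^ 4 - x ^ 3 - x ^ 2 + 3 * x - 1 = 0) {K : ℕ} (hK : 1 ≤ K) {y : ℝ}
    (hy : y = x * (1 + x ^ K / 200)) :
    0 < y ∧ y < 1 ∧ 0 ≤ 1 - y - y ^ (K + 1) ∧
      y ^ 4 ≤ (1 - 2 * y - y ^ 2 + y ^ (K + 3)) * (1 - y - y ^ (K + 1)) := by
  have hx0' : 0 ≤ x := by linarith
  have hp0 : 0 ≤ x ^ K := pow_nonneg hx0' K
  have hp1 : x ^ K ≤ x := by
    simpa using pow_le_pow_of_le_one hx0' (by linarith : x ≤ 1) hK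
  have hxy : x ≤ y := by rw [hy]; nlinarith
  have hy1 : y ≤ 0.402 := by
    have h1 : x * (1 + x ^ K / 200) ≤ 0.4 * (1 + 0.4 / 200) := by
      gcongr
      exact hp1.trans hx1
    rw [hy]
    norm_num at h1 ⊢
    linarith
  have hy0 : 0 ≤ y := by linarith
  set z := y ^ (K + 1) with hz
  have hz0 : 0 ≤ z := pow_nonneg hy0 _
  have hz1 : z ≤ 0.162 := by
    have h1 : z ≤ y ^ 2 := pow_le_pow_of_le_one hy0 (by linarith) (by omega)
    nlinarith
  have hzx : 0.399 * x ^ K ≤ z := by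
    have h1 : x ^ (K + 1) ≤ z := pow_le_pow_left₀ hx0' hxy _
    rw [pow_succ] at h1
    nlinarith
  have hz3 : y ^ (K + 3) = z * y ^ 2 := by rw [hz, ← pow_add]
  have hd : y - x ≤ 0.002 * x ^ K := by
    have h1 : y - x = x * x ^ K / 200 := by rw [hy]; ring
    rw [h1]
    nlinarith
  have hP : -3 * (y - x) ≤ y ^ 2 * (y + 1) - 3 * y + 1 - y ^ 4 := by
    have h1 : y ^ 2 * (y + 1) - 3 * y + 1 - y ^ 4 = (y - x) *
        (y ^ 2 + x * y + x ^ 2 + (y + x) - 3 - (y + x) * (y ^ 2 + x ^ 2)) := by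
      linear_combination -hx
    rw [h1]
    have h2 : 0 ≤ y - x := by linarith
    have h3 : 0 ≤ y ^ 2 + x * y + x ^ 2 + (y + x) - (y + x) * (y ^ 2 + x ^ 2) := by
      have h4 : y ^ 2 + x ^ 2 ≤ 1 := by nlinarith
      have h5 : (y + x) * (y ^ 2 + x ^ 2) ≤ (y + x) * 1 := by gcongr
      have h6 : 0 ≤ x * y := by positivity
      nlinarith [sq_nonneg x, sq_nonneg y]
    nlinarith
  have hb : 0.016 ≤ 2 * y ^ 2 - y ^ 3 + 2 * y - 1 - y ^ 2 * z := by
    have h1 : y ^ 2 * z ≤ y ^ 2 * 0.162 := by gcongr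
    have h2 : y ^ 3 ≤ 0.402 * y ^ 2 := by
      have := mul_le_mul_of_nonneg_right hy1 (sq_nonneg y)
      linarith [show y ^ 3 = y * y ^ 2 by ring]
    have h3 : 0.399 ^ 2 ≤ y ^ 2 := pow_le_pow_left₀ (by norm_num) (by linarith) 2
    norm_num at h3
    linarith
  refine ⟨by linarith, by linarith, by linarith, ?_⟩
  rw [hz3]
  have hzb : z * 0.016 ≤ z * (2 * y ^ 2 - y ^ 3 + 2 * y - 1 - y ^ 2 * z) := by gcongr
  have he : (1 - 2 * y - y ^ 2 + z * y ^ 2) * (1 - y - z) - y ^ 4 =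
      (y ^ 2 * (y + 1) - 3 * y + 1 - y ^ 4) +
        z * (2 * y ^ 2 - y ^ 3 + 2 * y - 1 - y ^ 2 * z) := by ring
  linarith

/-- The even length lets Bernoulli's inequality for `(1 + t)^q` give a squared denominator. With a
first power, `q` times the sum over `K` would grow logarithmically. -/
theorem card_negRunsFinset_mul_le (hx0 : 0.399 ≤ x) (hx1 : x ≤ 0.4)
    (hx : x ^ 4 - x ^ 3 - x ^ 2 + 3 * x - 1 = 0) {K q : ℕ} (hK : 1 ≤ K) (hKn : K < 2 * q) :
    ((negRunsFinset K (2 * q - (K + 1))).card : ℝ) * x ^ (2 * q) ≤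
      3 * x ^ K / (1 + q * (x ^ K / 200)) ^ 2 := by
  have hx0' : 0 < x := by linarith
  set t := x ^ K / 200 with ht
  have ht0 : 0 ≤ t := by positivity
  obtain ⟨hy0, hy1, hv, hdet⟩ := perturbed_inequalities hx0 hx1 hx hK (y := x * (1 + t)) rfl
  have h1 := card_negRunsFinset_le hy0 hy1 hv hdet (2 * q - (K + 1))
  set c := ((negRunsFinset K (2 * q - (K + 1))).card : ℝ) with hc
  have hc0 : 0 ≤ c := Nat.cast_nonneg _
  have h2 : c * (x * (1 + t)) ^ (2 * q) ≤ (x * (1 + t)) ^ (K + 1) := by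
    have : (x * (1 + t)) ^ (2 * q) =
        (x * (1 + t)) ^ (2 * q - (K + 1)) * (x * (1 + t)) ^ (K + 1) := by
      rw [← pow_add]; congr 1; omega
    rw [this, ← mul_assoc]
    exact mul_le_of_le_one_left (by positivity) h1
  have h3 : (1 + t) ^ (K + 1) ≤ 3 := by
    have h4 : (1 + t) ^ (K + 1) ≤ Real.exp (t * (K + 1)) := by
      have : 1 + t ≤ Real.exp t := by linarith [Real.add_one_le_exp t]
      calc (1 + t) ^ (K + 1) ≤ Real.exp t ^ (K + 1) := by gcongr
        _ = Real.exp (t * (K + 1)) := by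
          rw [← Real.exp_nat_mul]; congr 1; push_cast; ring
    have h5 : t * (K + 1) ≤ 1 := by
      have h6 : (K + 1 : ℝ) ≤ 2 ^ K := by
        have : K + 1 ≤ 2 ^ K := Nat.lt_two_pow_self
        exact_mod_cast this
      have h7 : x ^ K * 2 ^ K ≤ 1 := by
        rw [← mul_pow]
        exact pow_le_one₀ (by positivity) (by linarith)
      have h8 : x ^ K * (K + 1) ≤ x ^ K * 2 ^ K := by gcongr
      rw [ht]
      linarith
    have h9 : Real.exp (t * (K + 1)) ≤ Real.exp 1 := Real.exp_le_exp.2 h5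
    linarith [Real.exp_one_lt_three]
  have h4 : (1 + q * t) ^ 2 ≤ (1 + t) ^ (2 * q) := by
    rw [mul_comm 2 q, pow_mul]
    have := one_add_mul_le_pow (by linarith : -2 ≤ t) q
    gcongr
  have h5 : x ^ (K + 1) ≤ x ^ K := pow_le_pow_of_le_one hx0'.le (by linarith) (by omega)
  have hpos : 0 < (1 + q * t) ^ 2 := by positivity
  rw [le_div_iff₀ hpos]
  calc c * x ^ (2 * q) * (1 + q * t) ^ 2 ≤ c * x ^ (2 * q) * (1 + t) ^ (2 * q) := by gcongr
    _ = c * (x * (1 + t)) ^ (2 * q) := by rw [mul_pow]; ring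
    _ ≤ (x * (1 + t)) ^ (K + 1) := h2
    _ = x ^ (K + 1) * (1 + t) ^ (K + 1) := mul_pow _ _ _
    _ ≤ x ^ K * 3 := by gcongr
    _ = 3 * x ^ K := mul_comm _ _

/-- Telescoping: each term times `1 - x` is at most the increment of `1/(1 + s x^K)` from `K` to `K
+ 1`. The resulting bound is uniform in `s`. -/
theorem sum_div_sq_le (hx0 : 0 < x) (hx1 : x < 1) {s : ℝ} (hs : 0 ≤ s) (n : ℕ) :
    (1 - x) * ∑ K ∈ Finset.range n, s * x ^ K / (1 + s * x ^ K) ^ 2 ≤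
      1 / (1 + s * x ^ n) - 1 / (1 + s) := by
  induction n with
  | zero => simp
  | succ n ih =>
    rw [Finset.sum_range_succ, mul_add]
    have h0 : 0 ≤ s * x ^ n := by positivity
    set u := s * x ^ n with hu
    have hu1 : s * x ^ (n + 1) = x * u := by rw [hu, pow_succ]; ring
    rw [hu1]
    have h1 : (1 - x) * (u / (1 + u) ^ 2) ≤ 1 / (1 + x * u) - 1 / (1 + u) := by
      have h2 : 1 / (1 + x * u) - 1 / (1 + u) = (1 - x) * u / ((1 + x * u) * (1 + u)) := by
        have : 0 < 1 + x * u := by positivity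
        field_simp
        ring
      rw [h2, ← mul_div_assoc]
      have : 0 ≤ 1 - x := by linarith
      have h3 : x * u ≤ u := mul_le_of_le_one_left h0 hx1.le
      rw [sq]
      gcongr
    linarith

theorem growth_PP_mul_le (hx0 : 0.399 ≤ x) (hx1 : x ≤ 0.4)
    (hx : x ^ 4 - x ^ 3 - x ^ 2 + 3 * x - 1 = 0) (q : ℕ) :
    (growth (PP 2) (2 * q) : ℝ) * x ^ (2 * q) ≤
      Fintype.card (Equiv.Perm (Fin 2 × Bool)) *
        ((growth Rinf (2 * q) : ℝ) * x ^ (2 * q) + 2400) := by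
  have hx0' : 0 < x := by linarith
  have h1 : (growth (PP 2) (2 * q) : ℝ) ≤ Fintype.card (Equiv.Perm (Fin 2 × Bool)) *
      ((growth Rinf (2 * q) : ℝ) + (2 * q : ℕ) * ∑ K ∈ Finset.Ico 1 (2 * q),
        ((negRunsFinset K (2 * q - (K + 1))).card : ℝ)) := by
    exact_mod_cast growth_PP_le (2 * q)
  have h2 : ((2 * q : ℕ) : ℝ) * (∑ K ∈ Finset.Ico 1 (2 * q),
      ((negRunsFinset K (2 * q - (K + 1))).card : ℝ)) * x ^ (2 * q) ≤ 2400 := by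
    have h3 : (∑ K ∈ Finset.Ico 1 (2 * q),
        ((negRunsFinset K (2 * q - (K + 1))).card : ℝ)) * x ^ (2 * q) ≤
        ∑ K ∈ Finset.Ico 1 (2 * q), 3 * x ^ K / (1 + q * (x ^ K / 200)) ^ 2 := by
      rw [Finset.sum_mul]
      refine Finset.sum_le_sum fun K hK => ?_
      rw [Finset.mem_Ico] at hK
      exact card_negRunsFinset_mul_le hx0 hx1 hx hK.1 hK.2
    have h4 : ∑ K ∈ Finset.Ico 1 (2 * q), 3 * x ^ K / (1 + q * (x ^ K / 200)) ^ 2 ≤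
        ∑ K ∈ Finset.range (2 * q), 3 * x ^ K / (1 + q * (x ^ K / 200)) ^ 2 := by
      refine Finset.sum_le_sum_of_subset_of_nonneg ?_ fun K _ _ => by positivity
      intro K hK
      rw [Finset.mem_Ico] at hK
      exact Finset.mem_range.2 hK.2
    have h5 := sum_div_sq_le hx0' (by linarith) (s := q / 200) (by positivity) (2 * q)
    -- With `s = q/200`, the constant is `1200 = 2 · 3 · 200`; the remaining sum is at most `1/(1 -
    -- x) ≤ 2`.
    have h6 : ((2 * q : ℕ) : ℝ) * ∑ K ∈ Finset.range (2 * q),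
        3 * x ^ K / (1 + q * (x ^ K / 200)) ^ 2 =
        1200 * ∑ K ∈ Finset.range (2 * q), (q / 200 * x ^ K) / (1 + q / 200 * x ^ K) ^ 2 := by
      rw [Finset.mul_sum, Finset.mul_sum]
      refine Finset.sum_congr rfl fun K _ => ?_
      rw [show (q : ℝ) * (x ^ K / 200) = q / 200 * x ^ K by ring]
      push_cast
      ring
    have h7 : ∑ K ∈ Finset.range (2 * q), (q / 200 * x ^ K) / (1 + q / 200 * x ^ K) ^ 2 ≤ 2 := by
      have h8 : 1 / (1 + (q : ℝ) / 200 * x ^ (2 * q)) ≤ 1 := by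
        rw [div_le_one (by positivity)]
        have : 0 ≤ (q : ℝ) / 200 * x ^ (2 * q) := by positivity
        linarith
      have h9 : 0 ≤ 1 / (1 + (q : ℝ) / 200) := by positivity
      have h10 : 0 ≤ ∑ K ∈ Finset.range (2 * q),
          ((q : ℝ) / 200 * x ^ K) / (1 + q / 200 * x ^ K) ^ 2 :=
        Finset.sum_nonneg fun K _ => by positivity
      nlinarith
    calc _ = ((2 * q : ℕ) : ℝ) * ((∑ K ∈ Finset.Ico 1 (2 * q),
          ((negRunsFinset K (2 * q - (K + 1))).card : ℝ)) * x ^ (2 * q)) := mul_assoc _ _ _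
      _ ≤ ((2 * q : ℕ) : ℝ) * ∑ K ∈ Finset.range (2 * q),
          3 * x ^ K / (1 + q * (x ^ K / 200)) ^ 2 := by
        gcongr
        exact h3.trans h4
      _ ≤ 2400 := by rw [h6]; linarith
  refine (mul_le_mul_of_nonneg_right h1 (pow_nonneg hx0'.le (2 * q))).trans ?_
  calc _ = Fintype.card (Equiv.Perm (Fin 2 × Bool)) * ((growth Rinf (2 * q) : ℝ) * x ^ (2 * q) +
        ((2 * q : ℕ) : ℝ) * (∑ K ∈ Finset.Ico 1 (2 * q),
          ((negRunsFinset K (2 * q - (K + 1))).card : ℝ)) * x ^ (2 * q)) := by ring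
    _ ≤ _ := by gcongr

theorem exists_growth_PP_le : ∃ C : ℝ, 1 ≤ C ∧ ∀ q : ℕ,
    (growth (PP 2) (2 * (q + 1)) : ℝ) ≤ C * growth Rinf (2 * (q + 1)) := by
  obtain ⟨x, hx0, hx1, hx⟩ := exists_inverse_growthRate
  have hx0' : 0 < x := by linarith
  set c : ℝ := (Fintype.card (Equiv.Perm (Fin 2 × Bool)) : ℝ) with hc
  have hc1 : 1 ≤ c := by
    rw [hc]
    exact_mod_cast Fintype.card_pos
  -- The lower bound 0.05 for `growth Rinf` times the power of `x` absorbs the additive constant,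
  -- since `2400 ≤ 49999 · 0.05`.
  refine ⟨c * 50000, by linarith, fun q => ?_⟩
  have h1 := growth_PP_mul_le hx0 hx1 hx (q + 1)
  have h2 := le_growth_rinf hx0'.le (by linarith) hx (2 * q)
  rw [show 2 * q + 2 = 2 * (q + 1) from by ring] at h2
  have hpow : x ^ (2 * (q + 1)) = x ^ (2 * q) * x ^ 2 := by rw [← pow_add]; ring_nf
  have h3 : 0.05 ≤ (growth Rinf (2 * (q + 1)) : ℝ) * x ^ (2 * (q + 1)) := by
    have h4 : (0.6 : ℝ) ^ 2 ≤ (1 - x) ^ 2 := pow_le_pow_left₀ (by norm_num) (by linarith) 2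
    have h5 : (0.399 : ℝ) ^ 2 ≤ x ^ 2 := pow_le_pow_left₀ (by norm_num) hx0 2
    rw [hpow, ← mul_assoc]
    calc (0.05 : ℝ) ≤ 0.6 ^ 2 * 0.399 ^ 2 := by norm_num
      _ ≤ _ := by
        gcongr
        linarith
  have hp : 0 < x ^ (2 * (q + 1)) := by positivity
  refine le_of_mul_le_mul_right (h1.trans ?_) hp
  have h6 : (growth Rinf (2 * (q + 1)) : ℝ) * x ^ (2 * (q + 1)) + 2400 ≤
      50000 * ((growth Rinf (2 * (q + 1)) : ℝ) * x ^ (2 * (q + 1))) := by linarith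
  calc c * ((growth Rinf (2 * (q + 1)) : ℝ) * x ^ (2 * (q + 1)) + 2400) ≤
      c * (50000 * ((growth Rinf (2 * (q + 1)) : ℝ) * x ^ (2 * (q + 1)))) := by gcongr
    _ = _ := by ring

theorem not_negligible_rinf : ¬ Negligible Rinf (PP 2) := by
  intro h
  obtain ⟨C, hC, hle⟩ := exists_growth_PP_le
  have hC0 : 0 < C := by linarith
  have hsub : Tendsto (fun q : ℕ => 2 * (q + 1)) atTop atTop :=
    tendsto_atTop_mono (fun q => by simp only [id]; omega) tendsto_id
  have h2 := h.comp hsub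
  -- Along the even lengths the density is at least `C⁻¹`, so a limit 0 would force this; `1 ≤ C`
  -- takes care of the added ones.
  have h3 : (C⁻¹ : ℝ) ≤ 0 := by
    refine ge_of_tendsto' h2 fun q => ?_
    simp only [Function.comp_apply, density]
    rw [inv_eq_one_div, div_le_div_iff₀ hC0 (by positivity)]
    have := hle q
    nlinarith
  have : 0 < C⁻¹ := inv_pos.2 hC0
  linarith

end Comparison

end PotPos

theorem lemma5p9 :
    PotPos.Rinf ⊆ PotPos.PP 2 ∧ ¬ PotPos.Negligible PotPos.Rinf (PotPos.PP 2) := by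
  exact ⟨PotPos.rinf_subset_PP, PotPos.not_negligible_rinf⟩
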